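/- Let $k$ be an algebraically closed field of any characteristic. For an algebraic set $X\subset\mathbb{A}^N$ over $k$ (all dimensions are Krull dimensions in the Zariski topology), let $\Delta(X)$ be the set of directions of lines contained in $X$, i.e. the set of points $v$ of the hyperplane at infinity $\mathbb{P}^N\setminus\mathbb{A}^N$ for which some line $l\subset X$ has closure passing through $v$. An $n$-dimensional closed subvariety $X\subset\mathbb{A}^N$ is called *Kakeya* if $\dim\Delta(X)=n-1$ (where $\Delta(X)$ is nonempty). A closed subvariety $X\subset\mathbb{A}^N$ of dimension $n$ together with a morphism $\pi:X\to\mathbb{A}^n$ is called a *Kakeya cover* if there is a nonempty Zariski-open subset $U$ of the hyperplane at infinity $\mathbb{P}^n\setminus\mathbb{A}^n$ such that for every $v\in U$ there is a line $l\subset X$ whose image $\pi(l)$ is a line in $\mathbb{A}^n$ in direction $v$. **Proposition.** Let $X\subset\mathbb{A}^N$ be an irreducible closed $n$-dimensional Kakeya subvariety, and let $d$ be the degree of its closure $\overline{X}\subset\mathbb{P}^N$. Then there is a composition $\varphi:\mathbb{A}^N\to\mathbb{A}^n$ of $N-n=\operatorname{codim}X$ successive linear projections $\mathbb{A}^{M+1}\to\mathbb{A}^{M}$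 $(M=N-1,\dots,n)$, each from a point at infinity that does not lie on the closure in $\mathbb{P}^{M+1}$ of the image of $X$ in $\mathbb{A}^{M+1}$ under the preceding projections, such that the restriction $\pi=\varphi|_X:X\to\mathbb{A}^n$ is a finite morphism of degree $[k(X):k(\mathbb{A}^n)]=d$ and is a Kakeya cover. -/

import Mathlib

open scoped LinearAlgebra.Projectivization

noncomputable section

namespace KakeyaCover

variable {k : Type*} [Field k]

/-! ### Affine and projective space with the Zariski topology

Affine `N`-space over an algebraically closed field `k` is the set `Fin N → k` of its points, and
projective `N`-space is `ℙ k (Fin (N + 1) → k)`, with homogeneous coordinates `x₀, …, x_N`. -/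

/-- The affine algebraic set cut out by a set `S` of polynomials. -/
def affineZeros {N : ℕ} (S : Set (MvPolynomial (Fin N) k)) : Set (Fin N → k) :=
  {x | ∀ f ∈ S, MvPolynomial.eval x f = 0}

/-- The homogeneous polynomials (of any degree) in `m` variables. -/
def forms (k : Type*) [Field k] (m : ℕ) : Set (MvPolynomial (Fin m) k) :=
  {f | ∃ e : ℕ, f.IsHomogeneous e}

/-- The projective algebraic set cut out by the homogeneous polynomials in `S`. Vanishing of a
homogeneous polynomial at a point does not depend on the representative of the point. -/
def projZeros {m : ℕ} (S : Set (MvPolynomial (Fin m) k)) : Set (ℙ k (Fin m → k)) :=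
  {p | ∀ f ∈ S, MvPolynomial.eval p.rep f = 0}

/-- The Zariski topology on affine space: the closed sets are the algebraic sets. -/
@[reducible]
def affineZariski (k : Type*) [Field k] (N : ℕ) : TopologicalSpace (Fin N → k) :=
  TopologicalSpace.ofClosed {Z | ∃ S : Set (MvPolynomial (Fin N) k), Z = affineZeros S}
    ⟨{1}, by ext x; simp [affineZeros]⟩
    (by
      intro A hA
      refine ⟨{f | ∃ Z ∈ A, ∀ x ∈ Z, MvPolynomial.eval x f = 0}, Set.Subset.antisymm ?_ ?_⟩
      · rintro x hx f ⟨Z, hZ, hf⟩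
        exact hf x (hx Z hZ)
      · intro x hx Z hZ
        obtain ⟨S, rfl⟩ := hA hZ
        exact fun f hf => hx f ⟨_, hZ, fun y hy => hy f hf⟩)
    (by
      rintro _ ⟨S, rfl⟩ _ ⟨T, rfl⟩
      refine ⟨{h | ∃ f ∈ S, ∃ g ∈ T, h = f * g}, Set.Subset.antisymm ?_ ?_⟩
      · rintro x (hx | hx) _ ⟨f, hf, g, hg, rfl⟩
        · simp [hx f hf]
        · simp [hx g hg]
      · intro x hx
        by_contra hn
        simp only [Set.mem_union, not_or, affineZeros, Set.mem_ofPred_eq, not_forall] at hn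
        obtain ⟨⟨f, hf, hfx⟩, g, hg, hgx⟩ := hn
        have := hx _ ⟨f, hf, g, hg, rfl⟩
        rw [map_mul, mul_eq_zero] at this
        exact this.elim hfx hgx)

/-- The Zariski topology on projective space: the closed sets are the projective algebraic sets. -/
@[reducible]
def projZariski (k : Type*) [Field k] (m : ℕ) : TopologicalSpace (ℙ k (Fin m → k)) :=
  TopologicalSpace.ofClosed {Z | ∃ S : Set (MvPolynomial (Fin m) k), S ⊆ forms k m ∧ Z = projZeros S}
    ⟨{1}, by
      rintro _ rfl
      exact ⟨0, MvPolynomial.isHomogeneous_one _ _⟩, by ext x; simp [projZeros]⟩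
    (by
      intro A hA
      refine ⟨{f | f ∈ forms k m ∧ ∃ Z ∈ A, ∀ p ∈ Z, MvPolynomial.eval p.rep f = 0},
        fun f hf => hf.1, Set.Subset.antisymm ?_ ?_⟩
      · rintro x hx f ⟨-, Z, hZ, hf⟩
        exact hf x (hx Z hZ)
      · intro x hx Z hZ
        obtain ⟨S, hS, rfl⟩ := hA hZ
        exact fun f hf => hx f ⟨hS hf, _, hZ, fun y hy => hy f hf⟩)
    (by
      rintro _ ⟨S, hS, rfl⟩ _ ⟨T, hT, rfl⟩
      refine ⟨{h | ∃ f ∈ S, ∃ g ∈ T, h = f * g}, ?_, Set.Subset.antisymm ?_ ?_⟩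
      · rintro _ ⟨f, hf, g, hg, rfl⟩
        obtain ⟨a, ha⟩ := hS hf
        obtain ⟨b, hb⟩ := hT hg
        exact ⟨a + b, ha.mul hb⟩
      · rintro x (hx | hx) _ ⟨f, hf, g, hg, rfl⟩
        · simp [hx f hf]
        · simp [hx g hg]
      · intro x hx
        by_contra hn
        simp only [Set.mem_union, not_or, projZeros, Set.mem_ofPred_eq, not_forall] at hn
        obtain ⟨⟨f, hf, hfx⟩, g, hg, hgx⟩ := hn
        have := hx _ ⟨f, hf, g, hg, rfl⟩
        rw [map_mul, mul_eq_zero] at this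
        exact this.elim hfx hgx)

attribute [local instance] affineZariski projZariski

/-- The open embedding `x ↦ [1 : x]` of affine space into projective space; the complement of its
image is the hyperplane at infinity `x₀ = 0`. -/
def toProj {N : ℕ} (x : Fin N → k) : ℙ k (Fin (N + 1) → k) :=
  Projectivization.mk k (Fin.cons 1 x) fun h => one_ne_zero (congrFun h 0)

/-- The linear map `v ↦ (0, v)`. -/
def consZero (k : Type*) [Field k] (N : ℕ) : (Fin N → k) →ₗ[k] (Fin (N + 1) → k) where
  toFun v := Fin.cons 0 v
  map_add' v w := by ext i; refine Fin.cases ?_ (fun j => ?_) i <;> simp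
  map_smul' c v := by ext i; refine Fin.cases ?_ (fun j => ?_) i <;> simp

theorem consZero_injective (k : Type*) [Field k] (N : ℕ) :
    Function.Injective (consZero k N) := by
  intro v w h
  ext i
  have := congrFun h i.succ
  simpa [consZero] using this

/-- The identification `[v] ↦ [0 : v]` of the space `ℙ k (Fin N → k)` of directions in affine
`N`-space with the hyperplane at infinity of projective `N`-space. -/
def atInfinity {N : ℕ} (v : ℙ k (Fin N → k)) : ℙ k (Fin (N + 1) → k) :=
  Projectivization.map (consZero k N) (consZero_injective k N) v

/-- The closure in projective `N`-space of a subset of affine `N`-space. -/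
def projClosure {N : ℕ} (X : Set (Fin N → k)) : Set (ℙ k (Fin (N + 1) → k)) :=
  closure (toProj '' X)

/-! ### The degree of a projective variety -/

/-- The forms of degree `e` that vanish on `Z`, as a subspace of the space of all forms of
degree `e`: the degree `e` part of the homogeneous ideal of `Z`. -/
def vanishingForms {m : ℕ} (Z : Set (ℙ k (Fin m → k))) (e : ℕ) :
    Submodule k (MvPolynomial.homogeneousSubmodule (Fin m) k e) where
  carrier := {f | ∀ p ∈ Z, MvPolynomial.eval p.rep (f : MvPolynomial (Fin m) k) = 0}
  zero_mem' := by intro p _; simp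
  add_mem' := by
    intro f g hf hg p hp
    simp [hf p hp, hg p hp]
  smul_mem' := by
    intro c f hf p hp
    simp [MvPolynomial.smul_eval, hf p hp]

/-- The Hilbert function of `Z`: the dimensions of the graded pieces of its homogeneous
coordinate ring. -/
def hilbertFunction {m : ℕ} (Z : Set (ℙ k (Fin m → k))) (e : ℕ) : ℕ :=
  Module.finrank k (MvPolynomial.homogeneousSubmodule (Fin m) k e ⧸ vanishingForms Z e)

/-- The projective variety `Z` of dimension `n` has degree `d`: its Hilbert function grows
like `(d / n!) e ^ n`, that is, its Hilbert polynomial has leading term `(d / n!) e ^ n`. -/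
def HasDegree {m : ℕ} (Z : Set (ℙ k (Fin m → k))) (n d : ℕ) : Prop :=
  Filter.Tendsto
    (fun e : ℕ => (n.factorial : ℝ) * (hilbertFunction Z e : ℝ) / (e : ℝ) ^ n)
    Filter.atTop (nhds (d : ℝ))

/-! ### Lines, directions, Kakeya subvarieties and Kakeya covers -/

/-- `l` is a line in affine space with direction `v`, i.e. its closure meets the hyperplane at
infinity in the point `v`. -/
def IsLine {N : ℕ} (l : Set (Fin N → k)) (v : ℙ k (Fin N → k)) : Prop :=
  ∃ a : Fin N → k, l = (AffineSubspace.mk' a v.submodule : Set (Fin N → k))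

/-- The set `Δ(X)` of directions of lines contained in `X`. -/
def directions {N : ℕ} (X : Set (Fin N → k)) : Set (ℙ k (Fin N → k)) :=
  {v | ∃ l, IsLine l v ∧ l ⊆ X}

/-- `X` is an `n`-dimensional Kakeya subvariety of affine space: `X` is closed, `dim X = n` and
`dim Δ(X) = n - 1`. Dimensions are Krull dimensions in the Zariski topology (`⊥` if empty). -/
structure IsKakeya {N : ℕ} (X : Set (Fin N → k)) (n : ℕ) : Prop where
  isClosed : IsClosed X
  dim_eq : topologicalKrullDim X = n
  dim_directions : topologicalKrullDim (directions X) + 1 = n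

/-- The polynomial map with components `p`; its restriction to a closed set `X` is a morphism
from `X` to affine `n`-space, and every such morphism is of this form. -/
def polyMap {N n : ℕ} (p : Fin n → MvPolynomial (Fin N) k) (x : Fin N → k) : Fin n → k :=
  fun i => MvPolynomial.eval x (p i)

/-- The subvariety `X` of dimension `n`, together with the morphism from `X` to affine `n`-space
given by the polynomials `p`, is a Kakeya cover. -/
structure IsKakeyaCover {N n : ℕ} (X : Set (Fin N → k)) (p : Fin n → MvPolynomial (Fin N) k) :
    Prop where
  isClosed : IsClosed X
  dim_eq : topologicalKrullDim X = n
  exists_open : ∃ U : Set (ℙ k (Fin n → k)), IsOpen U ∧ U.Nonempty ∧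
    ∀ v ∈ U, ∃ (l : Set (Fin N → k)) (w : ℙ k (Fin N → k)),
      IsLine l w ∧ l ⊆ X ∧ IsLine (polyMap p '' l) v

/-! ### Finite morphisms and their degrees -/

/-- The coordinate ring `k[X]`. -/
abbrev CoordRing {N : ℕ} (X : Set (Fin N → k)) : Type _ :=
  MvPolynomial (Fin N) k ⧸ MvPolynomial.vanishingIdeal k X

/-- The homomorphism `k[z₁, …, zₙ] → k[X]` corresponding to the morphism from `X` to affine
`n`-space given by the polynomials `p`. -/
def comorphism {N n : ℕ} (X : Set (Fin N → k)) (p : Fin n → MvPolynomial (Fin N) k) :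
    MvPolynomial (Fin n) k →ₐ[k] CoordRing X :=
  MvPolynomial.aeval fun i => Ideal.Quotient.mk (MvPolynomial.vanishingIdeal k X) (p i)

/-- The morphism from `X` to affine `n`-space given by `p` is finite. -/
def IsFiniteMorphism {N n : ℕ} (X : Set (Fin N → k)) (p : Fin n → MvPolynomial (Fin N) k) :
    Prop :=
  (comorphism X p).toRingHom.Finite

/-- The morphism from `X` to affine `n`-space given by `p` is dominant of degree `d`: it induces an
embedding of `k(z₁, …, zₙ)` into the function field `k(X)`, and the degree of this field
extension is finite and equal to `d`. -/
def HasMorphismDegree {N n : ℕ} (X : Set (Fin N → k)) (p : Fin n → MvPolynomial (Fin N) k)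
    (d : ℕ) : Prop :=
  ∃ g : FractionRing (MvPolynomial (Fin n) k) →+* FractionRing (CoordRing X),
    (∀ f : MvPolynomial (Fin n) k, g (algebraMap _ _ f) = algebraMap _ _ (comorphism X p f)) ∧
    letI : Module (FractionRing (MvPolynomial (Fin n) k)) (FractionRing (CoordRing X)) := g.toModule
    Module.Finite (FractionRing (MvPolynomial (Fin n) k)) (FractionRing (CoordRing X)) ∧
    Module.finrank (FractionRing (MvPolynomial (Fin n) k)) (FractionRing (CoordRing X)) = d

/-! ### Linear projections -/

/-- `φ` is the linear projection of affine `(N + 1)`-space from the point `P` at infinity onto a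
hyperplane not containing `P`, the affine part of the hyperplane being identified with affine
`N`-space by affine coordinates: `φ` is a surjective affine map whose fibres are the lines in
direction `P`. -/
def IsProjectionFrom {N : ℕ} (P : ℙ k (Fin (N + 1) → k))
    (φ : (Fin (N + 1) → k) →ᵃ[k] (Fin N → k)) : Prop :=
  Function.Surjective φ ∧ LinearMap.ker φ.linear = P.submodule

/-- `IsIteratedProjection c X φ`: the affine map `φ` is the composition of `c` successive linear
projections, the first one applied to `X` and each later one to the image of `X` so far, where the
centre of each is a point at infinity outside the projective closure of the set to which it is
applied. -/
inductive IsIteratedProjection {n : ℕ} : (c : ℕ) → {N : ℕ} → (X : Set (Fin N → k)) →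
    (φ : (Fin N → k) →ᵃ[k] (Fin n → k)) → Prop
  | refl (X : Set (Fin n → k)) : IsIteratedProjection 0 X (AffineMap.id k (Fin n → k))
  | step {c N : ℕ} (X : Set (Fin (N + 1) → k)) (P : ℙ k (Fin (N + 1) → k))
      (φ : (Fin (N + 1) → k) →ᵃ[k] (Fin N → k)) (ψ : (Fin N → k) →ᵃ[k] (Fin n → k))
      (hP : atInfinity P ∉ projClosure X) (hφ : IsProjectionFrom P φ)
      (hψ : IsIteratedProjection c (φ '' X) ψ) : IsIteratedProjection (c + 1) X (ψ.comp φ)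

end KakeyaCover

end

attribute [local instance] KakeyaCover.affineZariski KakeyaCover.projZariski

noncomputable section

namespace KakeyaCover

open MvPolynomial

variable {k : Type*} [Field k]

/-! ### Pulling back polynomials along linear maps -/

/-! Everything about the projection comes from one filtered form of Noether normalization,
`FilteredGenerates`: modulo the ideal of `X`, each polynomial of degree at most `e` is a sum of
products (pulled back polynomial) · (member of `M`) of degree at most `e`. For finite `M` this says
that the homogeneous coordinate ring of the projective closure, not only `k[X]`, is finite over a
polynomial ring. A projection from a point at infinity where the leading form of some equation of
`X` is nonzero has this property (`filteredGenerates_of_projection`), and the property survives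
composition. Integral injective maps preserve dimension, so such projections can be repeated until
the image fills affine `n`-space (`exists_isIteratedProjection`).

Degree: the Hilbert function of the closure counts functions on `X` of degree at most `e`. Up to
bounded shifts of `e` this is `r` times the dimension of the polynomials of degree at most `e` in
`n` variables, where `r` is the rank of `k[X]` over `k[z₁, …, zₙ]`. Hence the degree of the closure
and the degree of the field extension both equal `r` (`FilteredGenerates.exists_hasDegree`).

Kakeya cover: map the variety of pairs `(a, v)` with `a + t v ∈ X` for all `t` to affine `n`-space
by `(a, v) ↦ L v`. If the map is dominant, its image contains a nonempty open set by Chevalley's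
theorem, which yields the required lines. Otherwise some `g ≠ 0` vanishes on the image. Leading
forms of equations of `X` vanish on directions of lines in `X`, so the coordinate ring of the cone
over `Δ(X)` is finite over `k[z₁, …, zₙ]`; as `g` maps to zero in it, its dimension is below `n`.
Then `dim Δ(X) ≤ n - 2`, a contradiction (`FilteredGenerates.exists_open`). -/

/-- The homomorphism of polynomial rings given by composition with a linear map. -/
def pullback {N n : ℕ} (L : (Fin N → k) →ₗ[k] (Fin n → k)) :
    MvPolynomial (Fin n) k →ₐ[k] MvPolynomial (Fin N) k :=
  aeval (LinearMap.toMatrix' L).toMvPolynomial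

theorem eval_pullback {N n : ℕ} (L : (Fin N → k) →ₗ[k] (Fin n → k)) (f : MvPolynomial (Fin n) k)
    (x : Fin N → k) : eval x (pullback L f) = eval (L x) f := by
  rw [pullback, aeval_def, ← MvPolynomial.coe_eval₂Hom, ← RingHom.comp_apply]
  congr 1
  refine MvPolynomial.ringHom_ext (fun r => by simp) fun i => ?_
  simp [Matrix.toMvPolynomial_eval_eq_apply, LinearMap.toMatrix'_mulVec]

theorem isHomogeneous_pullback {N n e : ℕ} (L : (Fin N → k) →ₗ[k] (Fin n → k))
    {f : MvPolynomial (Fin n) k} (hf : f.IsHomogeneous e) :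
    (pullback L f).IsHomogeneous e := by
  have := hf.aeval (LinearMap.toMatrix' L).toMvPolynomial
    (fun i => Matrix.toMvPolynomial_isHomogeneous _ i)
  rwa [one_mul] at this

theorem totalDegree_pullback_le {N n : ℕ} (L : (Fin N → k) →ₗ[k] (Fin n → k))
    (f : MvPolynomial (Fin n) k) : (pullback L f).totalDegree ≤ f.totalDegree := by
  conv_lhs => rw [← sum_homogeneousComponent f, map_sum]
  refine totalDegree_finsetSum_le fun i hi => ?_
  exact (isHomogeneous_pullback L (homogeneousComponent_isHomogeneous i f)).totalDegree_le.trans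
    (Nat.lt_succ_iff.mp (Finset.mem_range.mp hi))

theorem pullback_comp [Infinite k] {N m n : ℕ} (L : (Fin N → k) →ₗ[k] (Fin m → k))
    (M : (Fin m → k) →ₗ[k] (Fin n → k)) (f : MvPolynomial (Fin n) k) :
    pullback (M ∘ₗ L) f = pullback L (pullback M f) :=
  MvPolynomial.funext fun x => by simp [eval_pullback]

theorem pullback_id [Infinite k] {n : ℕ} (f : MvPolynomial (Fin n) k) :
    pullback (LinearMap.id : (Fin n → k) →ₗ[k] (Fin n → k)) f = f :=
  MvPolynomial.funext fun x => by simp [eval_pullback]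

theorem pullback_mem_vanishingIdeal {N n : ℕ} {L : (Fin N → k) →ₗ[k] (Fin n → k)}
    {X : Set (Fin N → k)} {f : MvPolynomial (Fin n) k} :
    pullback L f ∈ vanishingIdeal k X ↔ f ∈ vanishingIdeal k (L '' X) := by
  simp [mem_vanishingIdeal_iff, aeval_eq_eval, eval_pullback]

/-! ### Linear maps that are finite with respect to the degree filtration -/

/-- The span of the products of degree at most `e` of a pulled back polynomial and a member
of `M`. -/
def filteredSpan {N n : ℕ} (L : (Fin N → k) →ₗ[k] (Fin n → k)) (M : Set (MvPolynomial (Fin N) k))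
    (e : ℕ) : Submodule k (MvPolynomial (Fin N) k) :=
  Submodule.span k {g | ∃ a, ∃ m ∈ M, a.totalDegree + m.totalDegree ≤ e ∧ pullback L a * m = g}

/-- The set `M` generates the coordinate ring of `X` over the polynomial ring, compatibly with
the filtrations by degree. -/
def FilteredGenerates {N n : ℕ} (X : Set (Fin N → k)) (L : (Fin N → k) →ₗ[k] (Fin n → k))
    (M : Set (MvPolynomial (Fin N) k)) : Prop :=
  ∀ e, ∀ f : MvPolynomial (Fin N) k, f.totalDegree ≤ e →
    f ∈ filteredSpan L M e ⊔ (vanishingIdeal k X).restrictScalars k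

theorem mul_mem_filteredSpan {N n e : ℕ} {L : (Fin N → k) →ₗ[k] (Fin n → k)}
    {M : Set (MvPolynomial (Fin N) k)} {a : MvPolynomial (Fin n) k} {m : MvPolynomial (Fin N) k}
    (hm : m ∈ M) (h : a.totalDegree + m.totalDegree ≤ e) : pullback L a * m ∈ filteredSpan L M e :=
  Submodule.subset_span ⟨a, m, hm, h, rfl⟩

theorem filteredSpan_le {N n e : ℕ} {L : (Fin N → k) →ₗ[k] (Fin n → k)}
    {M : Set (MvPolynomial (Fin N) k)} {V : Submodule k (MvPolynomial (Fin N) k)}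
    (h : ∀ a, ∀ m ∈ M, a.totalDegree + m.totalDegree ≤ e → pullback L a * m ∈ V) :
    filteredSpan L M e ≤ V :=
  Submodule.span_le.mpr fun _ ⟨a, m, hm, hd, hg⟩ => hg ▸ h a m hm hd

theorem filteredSpan_mono {N n e e' : ℕ} (L : (Fin N → k) →ₗ[k] (Fin n → k))
    (M : Set (MvPolynomial (Fin N) k)) (h : e ≤ e') : filteredSpan L M e ≤ filteredSpan L M e' :=
  filteredSpan_le fun _ _ hm hd => mul_mem_filteredSpan hm (hd.trans h)

theorem totalDegree_le_of_mem_filteredSpan {N n e : ℕ} {L : (Fin N → k) →ₗ[k] (Fin n → k)}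
    {M : Set (MvPolynomial (Fin N) k)} {f : MvPolynomial (Fin N) k}
    (hf : f ∈ filteredSpan L M e) : f.totalDegree ≤ e := by
  rw [← mem_restrictTotalDegree]
  refine (filteredSpan_le fun a m hm hd => ?_ : _ ≤ restrictTotalDegree (Fin N) k e) hf
  rw [mem_restrictTotalDegree]
  exact (totalDegree_mul _ _).trans ((add_le_add_left (totalDegree_pullback_le L a) _).trans hd)

/-- The coefficient `a` is itself reduced modulo the ideal of the image, whose pullback lies in the
ideal of `X`. Pulling back never raises the degree, so the bound survives. -/
theorem FilteredGenerates.comp [Infinite k] {N m n : ℕ} {X : Set (Fin N → k)}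
    {L : (Fin N → k) →ₗ[k] (Fin m → k)} {L' : (Fin m → k) →ₗ[k] (Fin n → k)}
    {M : Set (MvPolynomial (Fin N) k)} {M' : Set (MvPolynomial (Fin m) k)}
    (h : FilteredGenerates X L M) (h' : FilteredGenerates (L '' X) L' M') :
    FilteredGenerates X (L' ∘ₗ L) (Set.image2 (fun p q => pullback L p * q) M' M) := by
  intro e f hf
  refine (sup_le ?_ le_sup_right : filteredSpan L M e ⊔ (vanishingIdeal k X).restrictScalars k ≤ _)
    (h e f hf)
  refine filteredSpan_le fun a q hq hd => ?_
  obtain ⟨s, hs, t, ht, hst⟩ := Submodule.mem_sup.mp (h' _ a le_rfl)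
  rw [← hst, map_add, add_mul]
  refine add_mem (Submodule.mem_sup_left ?_) (Submodule.mem_sup_right ?_)
  · have hle : filteredSpan L' M' a.totalDegree ≤ (filteredSpan (L' ∘ₗ L)
        (Set.image2 (fun p q => pullback L p * q) M' M) e).comap
          ((LinearMap.mulRight k q) ∘ₗ (pullback L).toLinearMap) := by
      refine filteredSpan_le fun b p hp hd' => ?_
      simp only [Submodule.mem_comap, LinearMap.comp_apply, AlgHom.toLinearMap_apply,
        LinearMap.mulRight_apply, map_mul, ← pullback_comp, mul_assoc]
      refine mul_mem_filteredSpan (Set.mem_image2_of_mem hp hq) ?_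
      have h1 := totalDegree_mul (pullback L p) q
      have h2 := totalDegree_pullback_le L p
      omega
    exact hle hs
  · exact Ideal.mul_mem_right _ _ (pullback_mem_vanishingIdeal.mpr ht)

/-! ### A single projection -/

theorem monomial_mem_of_mul_mem {N : ℕ} (W : ℕ → Submodule k (MvPolynomial (Fin N) k))
    (h1 : 1 ∈ W 0) (hmul : ∀ e j, ∀ f ∈ W e, X j * f ∈ W (e + 1)) (s : Fin N →₀ ℕ) :
    monomial s 1 ∈ W s.degree := by
  induction h : s.degree generalizing s with
  | zero =>
    rw [Finsupp.degree_eq_zero_iff] at h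
    subst h
    exact h1
  | succ e ih =>
    have hs : s ≠ 0 := by rintro rfl; simp at h
    obtain ⟨j, hj⟩ := Finsupp.ne_iff.mp hs
    have hle : Finsupp.single j 1 ≤ s := by
      rw [Finsupp.single_le_iff]
      exact Nat.one_le_iff_ne_zero.mpr hj
    have hdec : Finsupp.single j 1 + (s - Finsupp.single j 1) = s := add_tsub_cancel_of_le hle
    have hdeg : (s - Finsupp.single j 1).degree = e := by
      have := congrArg Finsupp.degree hdec
      rw [map_add, Finsupp.degree_single, h] at this
      omega
    have := hmul e j _ (ih _ hdeg)
    rwa [X, monomial_mul, one_mul, hdec] at this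

theorem mem_of_monomial_mem {N : ℕ} (W : ℕ → Submodule k (MvPolynomial (Fin N) k))
    (hW : Monotone W) (h1 : 1 ∈ W 0) (hmul : ∀ e j, ∀ f ∈ W e, X j * f ∈ W (e + 1)) {e : ℕ}
    {f : MvPolynomial (Fin N) k} (hf : f.totalDegree ≤ e) : f ∈ W e := by
  rw [f.as_sum]
  refine Submodule.sum_mem _ fun s hs => ?_
  rw [← mul_one (coeff s f), ← smul_eq_mul, ← smul_monomial]
  refine Submodule.smul_mem _ _ (hW ?_ (monomial_mem_of_mul_mem W h1 hmul s))
  exact le_trans (le_of_eq (by rw [Finsupp.degree_apply]; rfl)) ((le_totalDegree hs).trans hf)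

/-- The linear form `∑ cᵢ Xᵢ`. -/
def linForm {N : ℕ} (c : (Fin N → k) →ₗ[k] k) : MvPolynomial (Fin N) k :=
  ∑ i, C (c (Pi.single i 1)) * X i

theorem eval_linForm {N : ℕ} (c : (Fin N → k) →ₗ[k] k) (x : Fin N → k) :
    eval x (linForm c) = c x := by
  rw [LinearMap.pi_apply_eq_sum_univ c x]
  have h : ∀ i : Fin N, (Pi.single i 1 : Fin N → k) = fun j => if i = j then 1 else 0 := fun i => by
    ext j
    simp [Pi.single_apply, eq_comm]
  simp [linForm, mul_comm, h]

theorem totalDegree_linForm_le {N : ℕ} (c : (Fin N → k) →ₗ[k] k) :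
    (linForm c).totalDegree ≤ 1 :=
  totalDegree_finsetSum_le fun i _ => (isHomogeneous_C_mul_X _ i).totalDegree_le

/-- If the kernel of `L` is spanned by `v` and `v j ≠ 0`, then every coordinate is a multiple
of `X j` plus a pulled back linear form. -/
theorem exists_X_eq [Infinite k] {N n : ℕ} {L : (Fin N → k) →ₗ[k] (Fin n → k)}
    (hL : Function.Surjective L) {v : Fin N → k} (hker : LinearMap.ker L = Submodule.span k {v})
    {j : Fin N} (hj : v j ≠ 0) (i : Fin N) : ∃ a : MvPolynomial (Fin n) k, ∃ c : k,
      a.totalDegree ≤ 1 ∧ X i = pullback L a + C c * X j := by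
  obtain ⟨σ, hσ⟩ := L.exists_rightInverse_of_surjective (LinearMap.range_eq_top.mpr hL)
  -- This form kills `v`, hence all of the kernel of `L`, so it factors through `L` by way of the
  -- section `σ`.
  let μ : (Fin N → k) →ₗ[k] k := LinearMap.proj i - (v i / v j) • LinearMap.proj j
  refine ⟨linForm (μ ∘ₗ σ), v i / v j, totalDegree_linForm_le _, MvPolynomial.funext fun x => ?_⟩
  have hx : x - σ (L x) ∈ LinearMap.ker L := by
    rw [LinearMap.mem_ker, map_sub, ← LinearMap.comp_apply, hσ, LinearMap.id_apply, sub_self]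
  rw [hker, Submodule.mem_span_singleton] at hx
  obtain ⟨b, hb⟩ := hx
  have hμ : μ (x - σ (L x)) = 0 := by
    rw [← hb]
    simp [μ]
    field_simp
    simp
  rw [map_sub, sub_eq_zero] at hμ
  simp only [map_add, map_mul, eval_pullback, eval_linForm, eval_X, eval_C, LinearMap.comp_apply,
    ← hμ]
  simp [μ]

/-- The ring upstairs is a polynomial ring in `X j` over the pulled back ring, compatibly with
degrees. -/
theorem mem_filteredSpan_powers [Infinite k] {N n : ℕ} {L : (Fin N → k) →ₗ[k] (Fin n → k)}
    (hL : Function.Surjective L) {v : Fin N → k} (hker : LinearMap.ker L = Submodule.span k {v})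
    {j : Fin N} (hj : v j ≠ 0) {e : ℕ} {f : MvPolynomial (Fin N) k} (hf : f.totalDegree ≤ e) :
    f ∈ filteredSpan L (Set.range fun i : ℕ => (X j : MvPolynomial (Fin N) k) ^ i) e := by
  refine mem_of_monomial_mem _ (fun _ _ => filteredSpan_mono L _) ?_ ?_ hf
  · simpa using mul_mem_filteredSpan (e := 0) (L := L) (a := 1)
      (Set.mem_range_self (f := fun i : ℕ => (X j : MvPolynomial (Fin N) k) ^ i) 0) (by simp)
  · intro e i f hf
    obtain ⟨b, c, hb, hX⟩ := exists_X_eq hL hker hj i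
    refine (filteredSpan_le fun a m hm hd => ?_ : _ ≤ (filteredSpan L (Set.range fun i : ℕ =>
      (X j : MvPolynomial (Fin N) k) ^ i) (e + 1)).comap (LinearMap.mulLeft k (X i))) hf
    obtain ⟨r, rfl⟩ := hm
    simp only [totalDegree_X_pow] at hd
    have h1 : X i * (pullback L a * X j ^ r) =
        pullback L (b * a) * X j ^ r + c • (pullback L a * X j ^ (r + 1)) := by
      rw [hX, map_mul, smul_eq_C_mul]; ring
    rw [Submodule.mem_comap, LinearMap.mulLeft_apply, h1]
    refine add_mem (mul_mem_filteredSpan (Set.mem_range_self r) ?_)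
      (Submodule.smul_mem _ _ (mul_mem_filteredSpan (Set.mem_range_self (r + 1)) ?_))
    · have := totalDegree_mul b a
      simp only [totalDegree_X_pow]
      omega
    · simp only [totalDegree_X_pow]
      omega

theorem eval_zero_of_isHomogeneous {N e : ℕ} {f : MvPolynomial (Fin N) k}
    (hf : f.IsHomogeneous e) (he : e ≠ 0) : eval 0 f = 0 := by
  rw [eval_zero, constantCoeff_eq]
  exact hf.coeff_eq_zero (by simpa using he.symm)

/-- The part of `a` contributing in degree `e` is a form of degree `e - i > 0`, which vanishes at `L
v = 0`. -/
theorem eval_homogeneousComponent_pullback_mul {N n : ℕ} {L : (Fin N → k) →ₗ[k] (Fin n → k)}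
    {v : Fin N → k} (hv : L v = 0) (a : MvPolynomial (Fin n) k) (j : Fin N) {i e : ℕ} (h : i < e) :
    eval v (homogeneousComponent e (pullback L a * X j ^ i)) = 0 := by
  rw [← sum_homogeneousComponent a, map_sum, Finset.sum_mul, map_sum, map_sum]
  refine Finset.sum_eq_zero fun r _ => ?_
  rw [homogeneousComponent_of_mem ((isHomogeneous_pullback L (homogeneousComponent_isHomogeneous r a)).mul
    (isHomogeneous_X_pow j i))]
  split_ifs with hr
  · rw [map_mul, eval_pullback, hv,
      eval_zero_of_isHomogeneous (homogeneousComponent_isHomogeneous r a) (by omega), zero_mul]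
  · simp

/-- Projection along a direction in which the leading form of a member of the ideal of `X`
does not vanish. -/
theorem filteredGenerates_of_projection [Infinite k] {N n : ℕ}
    {L : (Fin N → k) →ₗ[k] (Fin n → k)}
    (hL : Function.Surjective L) {v : Fin N → k} (hker : LinearMap.ker L = Submodule.span k {v})
    {j : Fin N} (hj : v j ≠ 0) {Z : Set (Fin N → k)} {f : MvPolynomial (Fin N) k}
    (hf : f ∈ vanishingIdeal k Z) {d : ℕ} (hd : f.totalDegree ≤ d)
    (hv : eval v (homogeneousComponent d f) ≠ 0) :
    FilteredGenerates Z L ((fun i : ℕ => (X j : MvPolynomial (Fin N) k) ^ i) '' Set.Iio d) := by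
  have hLv : L v = 0 := by
    rw [← LinearMap.mem_ker, hker]
    exact Submodule.mem_span_singleton_self v
  set M : Set (MvPolynomial (Fin N) k) :=
    (fun i : ℕ => (X j : MvPolynomial (Fin N) k) ^ i) '' Set.Iio d with hM
  set I := (vanishingIdeal k Z).restrictScalars k with hI
  -- Expand `f` in powers of `X j`. By degree, the coefficient of `X j ^ d` is a constant `c`; all
  -- lower terms have leading form zero at `v`, so `c ≠ 0`, and `f` becomes an integral equation for
  -- `X j` that respects degrees.
  have hpow : (X j : MvPolynomial (Fin N) k) ^ d ∈ filteredSpan L M d ⊔ I := by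
    have h1 := mem_filteredSpan_powers hL hker hj hd
    have h2 : filteredSpan L (Set.range fun i : ℕ => (X j : MvPolynomial (Fin N) k) ^ i) d ≤
        filteredSpan L M d ⊔ Submodule.span k {X j ^ d} := by
      refine filteredSpan_le fun a m hm hd' => ?_
      obtain ⟨i, rfl⟩ := hm
      simp only [totalDegree_X_pow] at hd' ⊢
      rcases lt_or_ge i d with hi | hi
      · exact Submodule.mem_sup_left (mul_mem_filteredSpan (Set.mem_image_of_mem _ hi)
          (by simpa using hd'))
      · obtain rfl : i = d := by omega
        refine Submodule.mem_sup_right (Submodule.mem_span_singleton.mpr ⟨coeff 0 a, ?_⟩)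
        have ha : a = C (coeff 0 a) := (totalDegree_eq_zero_iff_eq_C).mp (by omega)
        conv_rhs => rw [ha]
        rw [← algebraMap_eq, AlgHom.commutes, algebraMap_eq, smul_eq_C_mul]
    obtain ⟨w, hw, q, hq, hwq⟩ := Submodule.mem_sup.mp (h2 h1)
    obtain ⟨c, rfl⟩ := Submodule.mem_span_singleton.mp hq
    have hw0 : eval v (homogeneousComponent d w) = 0 := by
      have : filteredSpan L M d ≤ LinearMap.ker
          ((aeval v : MvPolynomial (Fin N) k →ₐ[k] k).toLinearMap ∘ₗ homogeneousComponent d) := by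
        refine filteredSpan_le fun a m hm _ => ?_
        obtain ⟨i, hi, rfl⟩ := hm
        rw [LinearMap.mem_ker, LinearMap.comp_apply, AlgHom.toLinearMap_apply, aeval_eq_eval]
        exact eval_homogeneousComponent_pullback_mul hLv a j hi
      have := this hw
      rwa [LinearMap.mem_ker, LinearMap.comp_apply, AlgHom.toLinearMap_apply, aeval_eq_eval] at this
    have hc : c ≠ 0 := by
      rintro rfl
      rw [zero_smul, add_zero] at hwq
      exact hv (hwq ▸ hw0)
    have : (X j : MvPolynomial (Fin N) k) ^ d = c⁻¹ • (f - w) := by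
      rw [← hwq, add_sub_cancel_left, smul_smul, inv_mul_cancel₀ hc, one_smul]
    rw [this]
    exact Submodule.smul_mem _ _ (sub_mem (Submodule.mem_sup_right hf) (Submodule.mem_sup_left hw))
  -- Powers beyond `d - 1` are removed by multiplying that equation by `pullback L a * X j ^ r`,
  -- without raising the degree.
  have hred : ∀ i a e, a.totalDegree + i ≤ e →
      pullback L a * X j ^ i ∈ filteredSpan L M e ⊔ I := by
    intro i
    induction i using Nat.strong_induction_on with
    | _ i ih =>
      intro a e hae
      rcases lt_or_ge i d with hi | hi
      · exact Submodule.mem_sup_left (mul_mem_filteredSpan (Set.mem_image_of_mem _ hi)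
          (by simpa using hae))
      · obtain ⟨r, rfl⟩ := Nat.exists_eq_add_of_le hi
        have hle : filteredSpan L M d ⊔ I ≤ (filteredSpan L M e ⊔ I).comap
            (LinearMap.mulLeft k (pullback L a * X j ^ r)) := by
          refine sup_le (filteredSpan_le fun b m hm hb => ?_) fun q hq => ?_
          · obtain ⟨s, hs, rfl⟩ := hm
            simp only [totalDegree_X_pow, Set.mem_Iio] at hb hs
            have h1 : pullback L a * X j ^ r * (pullback L b * X j ^ s) =
                pullback L (a * b) * X j ^ (s + r) := by
              rw [map_mul, pow_add]; ring
            rw [Submodule.mem_comap, LinearMap.mulLeft_apply, h1]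
            refine ih _ (by omega) _ _ ?_
            have := totalDegree_mul a b
            omega
          · exact Submodule.mem_sup_right (Ideal.mul_mem_left _ _ hq)
        have := hle hpow
        rw [Submodule.mem_comap, LinearMap.mulLeft_apply] at this
        rwa [pow_add, mul_comm (X j ^ d), ← mul_assoc]
  intro e g hg
  refine (filteredSpan_le fun a m hm hae => ?_ :
    filteredSpan L (Set.range fun i : ℕ => (X j : MvPolynomial (Fin N) k) ^ i) e ≤ _)
      (mem_filteredSpan_powers hL hker hj hg)
  obtain ⟨i, rfl⟩ := hm
  exact hred i a e (by simpa using hae)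

/-! ### Homogenization -/

/-- The homogenization, as a form of degree `e`, of a polynomial of degree at most `e`. -/
def homogenization {N : ℕ} (e : ℕ) (f : MvPolynomial (Fin N) k) : MvPolynomial (Fin (N + 1)) k :=
  ∑ i ∈ Finset.range (e + 1), X 0 ^ (e - i) * rename Fin.succ (homogeneousComponent i f)

theorem homogenization_isHomogeneous {N : ℕ} (e : ℕ) (f : MvPolynomial (Fin N) k) :
    (homogenization e f).IsHomogeneous e := by
  refine IsHomogeneous.sum _ _ _ fun i hi => ?_
  have h := (isHomogeneous_X_pow (R := k) (0 : Fin (N + 1)) (e - i)).mul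
    ((homogeneousComponent_isHomogeneous i f).rename_isHomogeneous (f := Fin.succ))
  rwa [Nat.sub_add_cancel (Nat.lt_succ_iff.mp (Finset.mem_range.mp hi))] at h

theorem eval_cons_one_homogenization {N e : ℕ} {f : MvPolynomial (Fin N) k}
    (hf : f.totalDegree ≤ e) (x : Fin N → k) :
    eval (Fin.cons 1 x) (homogenization e f) = eval x f := by
  have h : f = ∑ i ∈ Finset.range (e + 1), homogeneousComponent i f := by
    conv_lhs => rw [← sum_homogeneousComponent f]
    refine Finset.sum_subset (Finset.range_subset_range.mpr (by omega)) fun i _ hi => ?_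
    exact homogeneousComponent_eq_zero _ _ (by simpa using hi)
  conv_rhs => rw [h]
  simp [homogenization, eval_rename, Function.comp_def]

theorem eval_cons_zero_homogenization {N : ℕ} (e : ℕ) (f : MvPolynomial (Fin N) k)
    (v : Fin N → k) :
    eval (Fin.cons 0 v) (homogenization e f) = eval v (homogeneousComponent e f) := by
  rw [homogenization, map_sum, Finset.sum_eq_single_of_mem e (by simp)]
  · simp [eval_rename, Function.comp_def]
  · intro i hi hne
    have : e - i ≠ 0 := by have := Finset.mem_range.mp hi; omega
    simp [this]

theorem eval_smul_of_isHomogeneous {N e : ℕ} {f : MvPolynomial (Fin N) k}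
    (hf : f.IsHomogeneous e) (c : k) (x : Fin N → k) : eval (c • x) f = c ^ e * eval x f := by
  rw [eval_eq, eval_eq, Finset.mul_sum]
  refine Finset.sum_congr rfl fun s hs => ?_
  rw [hf.degree_eq_sum_deg_support hs, ← Finset.prod_pow_eq_pow_sum]
  simp only [Pi.smul_apply, smul_eq_mul, mul_pow, Finset.prod_mul_distrib]
  ring

theorem eval_rep_mk_eq_zero_iff {m e : ℕ} {f : MvPolynomial (Fin m) k} (hf : f.IsHomogeneous e)
    {x : Fin m → k} (hx : x ≠ 0) :
    eval (Projectivization.mk k x hx).rep f = 0 ↔ eval x f = 0 := by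
  obtain ⟨c, hc⟩ := Projectivization.exists_smul_eq_mk_rep k x hx
  rw [← hc, Units.smul_def, eval_smul_of_isHomogeneous hf]
  simp

theorem isClosed_projZeros {m : ℕ} {S : Set (MvPolynomial (Fin m) k)} (hS : S ⊆ forms k m) :
    IsClosed (projZeros S) := by
  refine ⟨?_⟩
  change (projZeros S)ᶜᶜ ∈ _
  rw [compl_compl]
  exact ⟨S, hS, rfl⟩

/-- A form vanishes on the projective closure of `X` if and only if it vanishes on `X`. -/
theorem forall_mem_projClosure_iff {N e : ℕ} {F : MvPolynomial (Fin (N + 1)) k}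
    (hF : F.IsHomogeneous e) (X : Set (Fin N → k)) :
    (∀ p ∈ projClosure X, eval p.rep F = 0) ↔ ∀ x ∈ X, eval (Fin.cons 1 x : Fin (N + 1) → k) F = 0 := by
  constructor
  · intro h x hx
    have := h (toProj x) (subset_closure (Set.mem_image_of_mem _ hx))
    rwa [toProj, eval_rep_mk_eq_zero_iff hF] at this
  · intro h p hp
    have hcl : IsClosed (projZeros {F}) :=
      isClosed_projZeros (Set.singleton_subset_iff.mpr ⟨e, hF⟩)
    have hsub : toProj '' X ⊆ projZeros {F} := by
      rintro _ ⟨x, hx, rfl⟩ _ rfl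
      rw [toProj, eval_rep_mk_eq_zero_iff hF]
      exact h x hx
    exact closure_minimal hsub hcl hp F rfl

/-- The degree `d` homogenization of `f` vanishes on the closure, and its value at `[0 : v]` is the
leading form at `v`. -/
theorem atInfinity_notMem_projClosure {N d : ℕ} {X : Set (Fin N → k)}
    {f : MvPolynomial (Fin N) k} (hf : f ∈ vanishingIdeal k X) (hd : f.totalDegree ≤ d)
    {v : Fin N → k} (hv0 : v ≠ 0) (hv : eval v (homogeneousComponent d f) ≠ 0) :
    atInfinity (Projectivization.mk k v hv0) ∉ projClosure X := by
  intro h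
  have h1 := (forall_mem_projClosure_iff (homogenization_isHomogeneous d f) X).mpr
    (fun x hx => by
      rw [eval_cons_one_homogenization hd]
      simpa [aeval_eq_eval] using mem_vanishingIdeal_iff.mp hf x hx) _ h
  rw [atInfinity, Projectivization.map_mk,
    eval_rep_mk_eq_zero_iff (homogenization_isHomogeneous d f)] at h1
  exact hv (by rw [← eval_cons_zero_homogenization]; exact h1)

/-! ### Krull dimension and integral extensions -/

/-- Incomparability: contraction of primes is strictly monotone along an integral map. -/
theorem ringKrullDim_le_of_isIntegral {R S : Type*} [CommRing R] [CommRing S] (f : R →+* S)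
    (hf : f.IsIntegral) : ringKrullDim S ≤ ringKrullDim R := by
  algebraize [f]
  refine Order.krullDim_le_of_strictMono (PrimeSpectrum.comap (algebraMap R S)) fun P Q h => ?_
  exact Ideal.IsIntegral.comap_lt_comap (R := R) (I := P.asIdeal) (J := Q.asIdeal) h

/-- For the other inequality, lying over lifts the bottom of a chain of primes and going up lifts
the rest. -/
theorem ringKrullDim_eq_of_isIntegral_of_injective {R S : Type*} [CommRing R] [CommRing S]
    (f : R →+* S) (hf : f.IsIntegral) (hinj : Function.Injective f) :
    ringKrullDim S = ringKrullDim R := by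
  refine le_antisymm (ringKrullDim_le_of_isIntegral f hf) ?_
  algebraize [f]
  have := Algebra.HasGoingUp.of_isIntegral (R := R) (S := S)
  refine iSup_le fun l => ?_
  obtain ⟨Q, -, hQ, hQ'⟩ := Ideal.exists_ideal_over_prime_of_isIntegral (S := S) l.head.asIdeal ⊥
    (by rw [← RingHom.ker_eq_comap_bot, (RingHom.injective_iff_ker_eq_bot (algebraMap R S)).mp hinj]
        exact bot_le)
  have : Q.LiesOver l.head.asIdeal := ⟨hQ'.symm⟩
  obtain ⟨l', hl', -⟩ := Ideal.exists_ltSeries_of_hasGoingUp l Q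
  rw [← hl']
  exact Order.LTSeries.length_le_krullDim l'

theorem ringKrullDim_mvPolynomial_fin (N : ℕ) : ringKrullDim (MvPolynomial (Fin N) k) = N := by
  simp

/-- `S` is integral over the image of `φ`, a quotient of a domain by an ideal containing `g ≠ 0`. -/
theorem ringKrullDim_add_one_le_of_mem {N : ℕ} {S : Type*} [CommRing S]
    (φ : MvPolynomial (Fin N) k →+* S) (hφ : φ.IsIntegral) {g : MvPolynomial (Fin N) k}
    (hg : g ≠ 0) (hφg : φ g = 0) : ringKrullDim S + 1 ≤ N := by
  have h1 : ringKrullDim S ≤ ringKrullDim (MvPolynomial (Fin N) k ⧸ RingHom.ker φ) :=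
    ringKrullDim_le_of_isIntegral (RingHom.kerLift φ) <| by
      refine RingHom.IsIntegral.tower_top (Ideal.Quotient.mk (RingHom.ker φ)) _ ?_
      have : (RingHom.kerLift φ).comp (Ideal.Quotient.mk (RingHom.ker φ)) = φ :=
        RingHom.ext fun x => RingHom.kerLift_mk φ x
      rwa [this]
  have h2 : ringKrullDim (MvPolynomial (Fin N) k ⧸ RingHom.ker φ) + 1 ≤ _ :=
    ringKrullDim_succ_le_of_surjective (Ideal.Quotient.mk (RingHom.ker φ))
      Ideal.Quotient.mk_surjective (r := g) (by simpa using hg) (Ideal.Quotient.eq_zero_iff_mem.mpr hφg)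
  rw [ringKrullDim_mvPolynomial_fin] at h2
  exact (add_le_add_left h1 1).trans h2

/-! ### Coordinate rings and linear maps -/

theorem comorphism_pullback_X {N n : ℕ} (Z : Set (Fin N → k))
    (L : (Fin N → k) →ₗ[k] (Fin n → k)) (f : MvPolynomial (Fin n) k) :
    comorphism Z (fun i => pullback L (X i)) f =
      Ideal.Quotient.mk (vanishingIdeal k Z) (pullback L f) := by
  have : comorphism Z (fun i => pullback L (X i)) =
      (Ideal.Quotient.mkₐ k (vanishingIdeal k Z)).comp (pullback L) :=
    MvPolynomial.algHom_ext fun i => by simp [comorphism]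
  rw [this]
  rfl

theorem finite_of_forall_mem_span {A B : Type*} [CommRing A] [CommRing B] [Algebra k A]
    [Algebra k B] (φ : A →ₐ[k] B) {T : Set B} (hT : T.Finite)
    (h : ∀ b, b ∈ Submodule.span k {y | ∃ a, ∃ m ∈ T, φ a * m = y}) :
    φ.toRingHom.Finite := by
  algebraize [φ.toRingHom]
  have hsmul : ∀ (a : A) (b : B), a • b = φ a * b := fun _ _ => rfl
  refine ⟨hT.toFinset, ?_⟩
  rw [eq_top_iff, Set.Finite.coe_toFinset]
  rintro x -
  induction h x using Submodule.span_induction with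
  | mem x hx =>
    obtain ⟨a, m, hm, rfl⟩ := hx
    rw [← hsmul]
    exact Submodule.smul_mem _ _ (Submodule.subset_span hm)
  | zero => exact zero_mem _
  | add x y _ _ hx hy => exact add_mem hx hy
  | smul c x _ hx =>
    have : c • x = (algebraMap k A c) • x := by
      rw [hsmul, AlgHom.commutes, Algebra.smul_def]
    rw [this]
    exact Submodule.smul_mem _ _ hx

theorem FilteredGenerates.finite {N n : ℕ} {Z : Set (Fin N → k)}
    {L : (Fin N → k) →ₗ[k] (Fin n → k)} {M : Set (MvPolynomial (Fin N) k)}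
    (h : FilteredGenerates Z L M) (hM : M.Finite) :
    IsFiniteMorphism Z (fun i => pullback L (X i)) := by
  refine finite_of_forall_mem_span _ (hM.image (Ideal.Quotient.mk (vanishingIdeal k Z))) fun x => ?_
  obtain ⟨f, rfl⟩ := Ideal.Quotient.mk_surjective x
  obtain ⟨s, hs, t, ht, rfl⟩ := Submodule.mem_sup.mp (h _ f le_rfl)
  rw [map_add, Ideal.Quotient.eq_zero_iff_mem.mpr ht, add_zero]
  refine (filteredSpan_le fun a m hm _ => ?_ : _ ≤ (Submodule.span k
    {y | ∃ a, ∃ m ∈ (Ideal.Quotient.mk (vanishingIdeal k Z)) '' M,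
      comorphism Z (fun i => pullback L (X i)) a * m = y}).comap
        (Ideal.Quotient.mkₐ k (vanishingIdeal k Z)).toLinearMap) hs
  refine Submodule.subset_span ⟨a, _, Set.mem_image_of_mem _ hm, ?_⟩
  rw [comorphism_pullback_X, ← map_mul]
  rfl

/-- The homomorphism of coordinate rings given by a linear map from `Z` onto its image. -/
def coordMap {N n : ℕ} (Z : Set (Fin N → k)) (L : (Fin N → k) →ₗ[k] (Fin n → k)) :
    CoordRing (L '' Z) →+* CoordRing Z :=
  Ideal.quotientMap _ (pullback L).toRingHom fun _ hf => pullback_mem_vanishingIdeal.mpr hf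

theorem coordMap_injective {N n : ℕ} (Z : Set (Fin N → k)) (L : (Fin N → k) →ₗ[k] (Fin n → k)) :
    Function.Injective (coordMap Z L) :=
  Ideal.quotientMap_injective' fun _ hf => pullback_mem_vanishingIdeal.mp hf

theorem FilteredGenerates.coordMap_isIntegral {N n : ℕ} {Z : Set (Fin N → k)}
    {L : (Fin N → k) →ₗ[k] (Fin n → k)} {M : Set (MvPolynomial (Fin N) k)}
    (h : FilteredGenerates Z L M) (hM : M.Finite) : (coordMap Z L).IsIntegral := by
  refine RingHom.IsIntegral.tower_top (Ideal.Quotient.mk (vanishingIdeal k (L '' Z))) _ ?_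
  have : (coordMap Z L).comp (Ideal.Quotient.mk (vanishingIdeal k (L '' Z))) =
      (comorphism Z (fun i => pullback L (X i))).toRingHom :=
    RingHom.ext fun f => (comorphism_pullback_X Z L f).symm
  rw [this]
  exact (h.finite hM).to_isIntegral

theorem vanishingIdeal_image_isPrime {N n : ℕ} {Z : Set (Fin N → k)}
    (L : (Fin N → k) →ₗ[k] (Fin n → k)) (hZ : (vanishingIdeal k Z).IsPrime) :
    (vanishingIdeal k (L '' Z)).IsPrime := by
  have : vanishingIdeal k (L '' Z) = (vanishingIdeal k Z).comap (pullback L) :=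
    Ideal.ext fun _ => pullback_mem_vanishingIdeal.symm
  rw [this]
  infer_instance

theorem vanishingIdeal_eq_bot_of_ringKrullDim {N : ℕ} {Z : Set (Fin N → k)}
    (hdim : ringKrullDim (CoordRing Z) = N) : vanishingIdeal k Z = ⊥ := by
  by_contra h
  obtain ⟨g, hg, hg0⟩ := Submodule.exists_mem_ne_zero_of_ne_bot h
  have h1 := ringKrullDim_add_one_le_of_mem (Ideal.Quotient.mk (vanishingIdeal k Z))
    (RingHom.isIntegral_of_surjective _ Ideal.Quotient.mk_surjective) hg0
    (Ideal.Quotient.eq_zero_iff_mem.mpr hg)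
  rw [hdim] at h1
  have : ((N + 1 : ℕ) : WithBot ℕ∞) ≤ ((N : ℕ) : WithBot ℕ∞) := by exact_mod_cast h1
  have := Nat.cast_le.mp this
  omega

/-! ### Choice of centres and iterated projection -/

theorem exists_linearMap_ker_eq_span {N : ℕ} {v : Fin (N + 1) → k} (hv : v ≠ 0) :
    ∃ L : (Fin (N + 1) → k) →ₗ[k] (Fin N → k),
      Function.Surjective L ∧ LinearMap.ker L = Submodule.span k {v} := by
  have h : Module.finrank k ((Fin (N + 1) → k) ⧸ Submodule.span k {v}) =
      Module.finrank k (Fin N → k) := by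
    have := Submodule.finrank_quotient_add_finrank (Submodule.span k {v})
    rw [finrank_span_singleton hv] at this
    simp only [Module.finrank_fin_fun] at this ⊢
    omega
  let E := LinearEquiv.ofFinrankEq _ _ h
  refine ⟨E.toLinearMap ∘ₗ (Submodule.span k {v}).mkQ,
    E.surjective.comp (Submodule.mkQ_surjective _), ?_⟩
  rw [LinearMap.ker_comp, LinearEquiv.ker, Submodule.comap_bot, Submodule.ker_mkQ]

theorem exists_direction [Infinite k] {N : ℕ} {Z : Set (Fin N → k)}
    (hZ : (vanishingIdeal k Z).IsPrime) {f : MvPolynomial (Fin N) k}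
    (hf : f ∈ vanishingIdeal k Z) (hf0 : f ≠ 0) :
    ∃ v : Fin N → k, v ≠ 0 ∧ eval v (homogeneousComponent f.totalDegree f) ≠ 0 := by
  have htop : homogeneousComponent f.totalDegree f ≠ 0 := by
    obtain ⟨s, hs, hsd⟩ := Finset.exists_mem_eq_sup f.support (by simpa using hf0)
      (fun s => s.degree)
    intro h0
    have := congrArg (coeff s) h0
    rw [coeff_homogeneousComponent, if_pos, coeff_zero] at this
    · exact mem_support_iff.mp hs this
    · rw [← hsd]; rfl
  have hex : ∃ v, eval v (homogeneousComponent f.totalDegree f) ≠ 0 := by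
    by_contra! h
    exact htop (MvPolynomial.funext fun v => by rw [h v, map_zero])
  obtain ⟨v, hv⟩ := hex
  refine ⟨v, ?_, hv⟩
  rintro rfl
  -- A leading form that is nonzero at the origin has degree zero; then `f` is a nonzero constant,
  -- impossible in a proper ideal.
  by_cases hd : f.totalDegree = 0
  · refine hZ.ne_top (Ideal.eq_top_of_isUnit_mem _ hf ?_)
    have hC := totalDegree_eq_zero_iff_eq_C.mp hd
    rw [hC]
    refine (isUnit_iff_ne_zero.mpr fun h0 => ?_ : IsUnit (coeff 0 f)).map C
    rw [h0, C_0] at hC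
    exact hf0 hC
  · exact hv (eval_zero_of_isHomogeneous (homogeneousComponent_isHomogeneous _ f) hd)

/-- An affine variety of dimension `n` can be projected onto affine `n`-space. -/
theorem exists_isIteratedProjection [Infinite k] {n : ℕ} (c : ℕ) (Z : Set (Fin (n + c) → k))
    (hZ : (vanishingIdeal k Z).IsPrime) (hdim : ringKrullDim (CoordRing Z) = n) :
    ∃ (L : (Fin (n + c) → k) →ₗ[k] (Fin n → k)) (M : Set (MvPolynomial (Fin (n + c)) k)),
      M.Finite ∧ IsIteratedProjection c Z L.toAffineMap ∧ FilteredGenerates Z L M ∧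
        ∀ f, pullback L f ∈ vanishingIdeal k Z → f = 0 := by
  induction c with
  | zero =>
    refine ⟨LinearMap.id, {1}, Set.finite_singleton _, IsIteratedProjection.refl _,
      fun e f hf => Submodule.mem_sup_left ?_, fun f hf => ?_⟩
    · have := mul_mem_filteredSpan (L := (LinearMap.id : (Fin n → k) →ₗ[k] (Fin n → k))) (a := f)
        (Set.mem_singleton (1 : MvPolynomial (Fin n) k)) (e := e) (by simpa using hf)
      rwa [pullback_id, mul_one] at this
    · have h0 : vanishingIdeal k Z = ⊥ := vanishingIdeal_eq_bot_of_ringKrullDim hdim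
      rw [h0] at hf
      have hf : pullback LinearMap.id f = 0 := hf
      rwa [pullback_id] at hf
  | succ c ih =>
    have hne : vanishingIdeal k Z ≠ ⊥ := by
      intro h0
      have h1 : ringKrullDim (CoordRing Z) = ringKrullDim (MvPolynomial (Fin (n + (c + 1))) k) :=
        (ringKrullDim_eq_of_isIntegral_of_injective (Ideal.Quotient.mk (vanishingIdeal k Z))
          (RingHom.isIntegral_of_surjective _ Ideal.Quotient.mk_surjective)
          (by rw [RingHom.injective_iff_ker_eq_bot, Ideal.mk_ker, h0]))
      rw [hdim, ringKrullDim_mvPolynomial_fin] at h1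
      have := Nat.cast_injective h1
      omega
    obtain ⟨f, hf, hf0⟩ := Submodule.exists_mem_ne_zero_of_ne_bot hne
    obtain ⟨v, hv0, hv⟩ := exists_direction hZ hf hf0
    obtain ⟨j, hj⟩ := Function.ne_iff.mp hv0
    obtain ⟨L, hL, hker⟩ := exists_linearMap_ker_eq_span (N := n + c) hv0
    have hgen := filteredGenerates_of_projection hL hker hj hf le_rfl hv
    have hfin := (Set.finite_Iio f.totalDegree).image
      (fun i : ℕ => (X j : MvPolynomial (Fin (n + (c + 1))) k) ^ i)
    -- The induction uses only the ideal of the image, so closedness of `L '' Z` is not needed.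
    have hdim' : ringKrullDim (CoordRing (L '' Z)) = n := by
      rw [← hdim]
      exact (ringKrullDim_eq_of_isIntegral_of_injective _ (hgen.coordMap_isIntegral hfin)
        (coordMap_injective Z L)).symm
    obtain ⟨L', M', hM', hproj, hgen', hinj⟩ :=
      ih (L '' Z) (vanishingIdeal_image_isPrime L hZ) hdim'
    refine ⟨L' ∘ₗ L, _, hM'.image2 _ hfin, ?_, hgen.comp hgen', fun g hg => ?_⟩
    · refine IsIteratedProjection.step Z (Projectivization.mk k v hv0) L.toAffineMap
        L'.toAffineMap (atInfinity_notMem_projClosure hf le_rfl hv0 hv) ⟨hL, ?_⟩ hproj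
      rw [Projectivization.submodule_mk]
      exact hker
    · rw [pullback_comp, pullback_mem_vanishingIdeal] at hg
      exact hinj g hg

/-! ### The dimension of the space of polynomials of bounded degree -/

/-- The slack `e - ∑ sᵢ` serves as an extra coordinate, turning the inequality into an equality
counted by multisets. -/
theorem card_degree_le (n e : ℕ) :
    Nat.card {s : Fin n →₀ ℕ | (s.sum fun _ i => i) ≤ e} = (n + e).choose n := by
  have E : {s : Fin n →₀ ℕ | (s.sum fun _ i => i) ≤ e} ≃ {P : Fin (n + 1) → ℕ // ∑ i, P i = e} :=
    { toFun := fun s => ⟨Fin.cons (e - s.1.sum fun _ i => i) s.1, by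
        have := s.2
        simp only [Set.mem_ofPred_eq] at this
        rw [Fin.sum_univ_succ]
        simp only [Fin.cons_zero, Fin.cons_succ]
        rw [Finsupp.sum_fintype _ _ (fun _ => rfl)] at this ⊢
        omega⟩
      invFun := fun P => ⟨Finsupp.equivFunOnFinite.symm (Fin.tail P.1), by
        have := P.2
        rw [Fin.sum_univ_succ] at this
        simp only [Set.mem_ofPred_eq]
        rw [Finsupp.sum_fintype _ _ (fun _ => rfl)]
        simp only [Finsupp.equivFunOnFinite_symm_apply_apply, Fin.tail]
        omega⟩
      left_inv := fun s => by
        ext i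
        simp
      right_inv := fun P => by
        have h := P.2
        rw [Fin.sum_univ_succ] at h
        ext i
        refine Fin.cases ?_ (fun j => ?_) i
        · simp only [Fin.cons_zero]
          rw [Finsupp.sum_fintype _ _ (fun _ => rfl)]
          simp only [Finsupp.equivFunOnFinite_symm_apply_apply, Fin.tail]
          omega
        · simp [Fin.tail] }
  rw [Nat.card_congr (E.trans (Sym.equivNatSumOfFintype (Fin (n + 1)) e).symm),
    Nat.card_eq_fintype_card, Sym.card_sym_eq_choose, Fintype.card_fin]
  have : n + 1 + e - 1 = n + e := by omega
  rw [this, Nat.choose_symm_add]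

theorem finrank_restrictTotalDegree (n e : ℕ) :
    Module.finrank k (restrictTotalDegree (Fin n) k e) = (n + e).choose n := by
  rw [← card_degree_le]
  exact Module.finrank_eq_nat_card_basis (basisRestrictSupport k _)

theorem factorial_mul_finrank_restrictTotalDegree (n e : ℕ) :
    n.factorial * Module.finrank k (restrictTotalDegree (Fin n) k e) = (e + 1).ascFactorial n := by
  rw [finrank_restrictTotalDegree, Nat.ascFactorial_eq_factorial_mul_choose, add_comm e n]

/-- `n!` times the dimension is `(e + 1) ⋯ (e + n)`, which lies between `(e + 1) ^ n` and `(e + n) ^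
n`; the shifts by `c` and `C` disappear in the limit. -/
theorem tendsto_of_le_of_le {n d c C : ℕ} {h : ℕ → ℕ}
    (hlow : ∀ e, d * Module.finrank k (restrictTotalDegree (Fin n) k e) ≤ h (e + c))
    (hup : ∀ e, h e ≤ d * Module.finrank k (restrictTotalDegree (Fin n) k (e + C))) :
    Filter.Tendsto (fun e : ℕ => (n.factorial : ℝ) * (h e : ℝ) / (e : ℝ) ^ n)
      Filter.atTop (nhds (d : ℝ)) := by
  have hlim : ∀ a : ℝ, Filter.Tendsto (fun e : ℕ => (d : ℝ) * (((e : ℝ) + a) / e) ^ n)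
      Filter.atTop (nhds (d : ℝ)) := by
    intro a
    have h1 : Filter.Tendsto (fun e : ℕ => ((e : ℝ) + a) / e) Filter.atTop (nhds 1) := by
      have h2 := (tendsto_const_div_atTop_nhds_zero_nat a).const_add 1
      rw [add_zero] at h2
      refine h2.congr' ?_
      filter_upwards [Filter.eventually_gt_atTop 0] with e he
      have : (e : ℝ) ≠ 0 := by positivity
      field_simp
    simpa using (h1.pow n).const_mul (d : ℝ)
  refine tendsto_of_tendsto_of_tendsto_of_le_of_le' (hlim (1 - c)) (hlim (C + n)) ?_ ?_
  · filter_upwards [Filter.eventually_ge_atTop c, Filter.eventually_gt_atTop 0] with e he he0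
    obtain ⟨r, rfl⟩ := Nat.exists_eq_add_of_le' he
    have h1 : d * (r + 1) ^ n ≤ n.factorial * h (r + c) :=
      calc d * (r + 1) ^ n ≤ d * (r + 1).ascFactorial n :=
            Nat.mul_le_mul_left _ (Nat.pow_succ_le_ascFactorial _ _)
        _ = n.factorial * (d * Module.finrank k (restrictTotalDegree (Fin n) k r)) := by
            rw [← factorial_mul_finrank_restrictTotalDegree (k := k)]; ring
        _ ≤ _ := Nat.mul_le_mul_left _ (hlow r)
    have h2 : (d : ℝ) * ((r : ℝ) + 1) ^ n ≤ (n.factorial : ℝ) * (h (r + c) : ℝ) := by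
      exact_mod_cast h1
    have h3 : ((r + c : ℕ) : ℝ) + (1 - c) = r + 1 := by push_cast; ring
    rw [h3, div_pow, ← mul_div_assoc]
    gcongr
  · filter_upwards [Filter.eventually_gt_atTop 0] with e he0
    have h1 : n.factorial * h e ≤ d * (e + C + n) ^ n :=
      calc n.factorial * h e ≤
            n.factorial * (d * Module.finrank k (restrictTotalDegree (Fin n) k (e + C))) :=
            Nat.mul_le_mul_left _ (hup e)
        _ = d * (e + C + 1).ascFactorial n := by
            rw [← factorial_mul_finrank_restrictTotalDegree (k := k)]; ring
        _ ≤ _ := Nat.mul_le_mul_left _ (Nat.ascFactorial_le_pow_add _ _)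
    have h2 : (n.factorial : ℝ) * (h e : ℝ) ≤ (d : ℝ) * ((e : ℝ) + (C + n)) ^ n := by
      rw [← add_assoc]
      exact_mod_cast h1
    rw [div_pow, ← mul_div_assoc]
    gcongr

/-! ### The growth of a filtered finite algebra over a polynomial ring -/

section Growth

variable {n : ℕ} {R : Type*} [CommRing R] [Algebra k R]
  [Algebra (MvPolynomial (Fin n) k) R] [IsScalarTower k (MvPolynomial (Fin n) k) R]

/-- The map sending coefficients of bounded degree to the linear combination of the `bᵢ`. -/
def combination {d : ℕ} (b : Fin d → R) (e : ℕ) :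
    (Fin d → restrictTotalDegree (Fin n) k e) →ₗ[k] R :=
  ((Fintype.linearCombination (MvPolynomial (Fin n) k) b).restrictScalars k) ∘ₗ
    (LinearMap.pi fun i => (restrictTotalDegree (Fin n) k e).subtype ∘ₗ LinearMap.proj i)

theorem combination_apply {d : ℕ} (b : Fin d → R) (e : ℕ)
    (a : Fin d → restrictTotalDegree (Fin n) k e) :
    combination b e a = ∑ i, (a i : MvPolynomial (Fin n) k) • b i := by
  simp [combination, Fintype.linearCombination_apply]

theorem combination_injective {d : ℕ} {b : Fin d → R}
    (hb : LinearIndependent (MvPolynomial (Fin n) k) b) (e : ℕ) :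
    Function.Injective (combination (k := k) (n := n) b e) := by
  rw [← LinearMap.ker_eq_bot, LinearMap.ker_eq_bot']
  intro a ha
  rw [combination_apply] at ha
  ext1 i
  exact Subtype.ext (Fintype.linearIndependent_iff.mp hb _ ha i)

theorem finrank_pi_restrictTotalDegree (d e : ℕ) :
    Module.finrank k (Fin d → restrictTotalDegree (Fin n) k e) =
      d * Module.finrank k (restrictTotalDegree (Fin n) k e) := by
  rw [Module.finrank_pi_fintype]
  simp

theorem mul_finrank_le {d : ℕ} {b : Fin d → R}
    (hb : LinearIndependent (MvPolynomial (Fin n) k) b) {e : ℕ} {W : Submodule k R}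
    [Module.Finite k W]
    (hW : ∀ i, ∀ a : MvPolynomial (Fin n) k, a.totalDegree ≤ e → a • b i ∈ W) :
    d * Module.finrank k (restrictTotalDegree (Fin n) k e) ≤ Module.finrank k W := by
  rw [← finrank_pi_restrictTotalDegree]
  refine LinearMap.finrank_le_finrank_of_injective (f := (combination b e).codRestrict W ?_) ?_
  · intro a
    rw [combination_apply]
    exact sum_mem fun i _ => hW i _ ((mem_restrictTotalDegree _ _ _).mp (a i).2)
  · rw [← LinearMap.ker_eq_bot, LinearMap.ker_codRestrict, LinearMap.ker_eq_bot]
    exact combination_injective hb e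

/-- Multiplication by `h` is injective on the domain `R` and carries `W` into the combinations of
the `b i`. -/
theorem finrank_le_mul [IsDomain R] {d : ℕ} (b : Fin d → R) {e : ℕ} {W : Submodule k R}
    {h : MvPolynomial (Fin n) k} (hh : algebraMap _ R h ≠ 0)
    (hW : ∀ w ∈ W, h • w ∈ LinearMap.range (combination (k := k) (n := n) b e)) :
    Module.finrank k W ≤ d * Module.finrank k (restrictTotalDegree (Fin n) k e) := by
  rw [← finrank_pi_restrictTotalDegree]
  refine le_trans ?_ (LinearMap.finrank_range_le (combination b e))
  let f : W →ₗ[k] LinearMap.range (combination (k := k) (n := n) b e) :=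
    ((LinearMap.mulLeft k (algebraMap (MvPolynomial (Fin n) k) R h)) ∘ₗ W.subtype).codRestrict _
      fun w => by simpa [Algebra.smul_def] using hW w w.2
  refine LinearMap.finrank_le_finrank_of_injective (f := f) ?_
  rw [← LinearMap.ker_eq_bot, LinearMap.ker_codRestrict, LinearMap.ker_eq_bot]
  intro x y hxy
  exact Subtype.ext (mul_left_cancel₀ hh hxy)

/-- By maximality of the rank, `m` and the `b i` are dependent; the coefficient of `m` is nonzero
because the `b i` alone are independent. -/
theorem exists_smul_eq_sum {A : Type*} [CommRing A] [IsDomain A] [Algebra A R]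
    [Module.Finite A R] {b : Fin (Module.finrank A R) → R} (hb : LinearIndependent A b) (m : R) :
    ∃ h : A, h ≠ 0 ∧ ∃ c : Fin (Module.finrank A R) → A, h • m = ∑ i, c i • b i := by
  have hdep : ¬ LinearIndependent A (Fin.cons m b : Fin (Module.finrank A R + 1) → R) := by
    intro hli
    have := hli.fintype_card_le_finrank
    simp at this
  obtain ⟨g, hsum, i, hi⟩ := Fintype.not_linearIndependent_iff.mp hdep
  rw [Fin.sum_univ_succ] at hsum
  simp only [Fin.cons_zero, Fin.cons_succ] at hsum
  refine ⟨g 0, fun h0 => ?_, fun i => - g i.succ, ?_⟩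
  · rw [h0, zero_smul, zero_add] at hsum
    have h1 := Fintype.linearIndependent_iff.mp hb _ hsum
    refine hi ?_
    induction i using Fin.cases with
    | zero => exact h0
    | succ j => exact h1 j
  · simp only [neg_smul, Finset.sum_neg_distrib]
    exact eq_neg_of_add_eq_zero_left hsum

theorem exists_common_smul_eq_sum {A : Type*} [CommRing A] [IsDomain A] [Algebra A R]
    [Module.Finite A R] {b : Fin (Module.finrank A R) → R} (hb : LinearIndependent A b)
    {T : Set R} (hT : T.Finite) :
    ∃ h : A, h ≠ 0 ∧ ∀ m ∈ T, ∃ c : Fin (Module.finrank A R) → A, h • m = ∑ i, c i • b i := by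
  induction T, hT using Set.Finite.induction_on with
  | empty => exact ⟨1, one_ne_zero, by simp⟩
  | @insert m T _ _ ih =>
    obtain ⟨h, hh, hc⟩ := ih
    obtain ⟨h', hh', c', hc'⟩ := exists_smul_eq_sum hb m
    refine ⟨h * h', mul_ne_zero hh hh', ?_⟩
    rintro x (rfl | hx)
    · refine ⟨fun i => h * c' i, ?_⟩
      simp only [mul_smul, hc', Finset.smul_sum]
    · obtain ⟨c, hcx⟩ := hc x hx
      refine ⟨fun i => h' * c i, ?_⟩
      rw [mul_comm]
      simp only [mul_smul, hcx, Finset.smul_sum]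

/-- `R` contains the free module on a maximal independent family `b`, and a common denominator `h`
of the generators carries `R` back into it. Both comparisons shift degrees by a bounded amount. -/
theorem tendsto_finrank_filtration [IsDomain R] [FaithfulSMul (MvPolynomial (Fin n) k) R]
    [Module.Finite (MvPolynomial (Fin n) k) R] (V : ℕ → Submodule k R)
    [∀ e, Module.Finite k (V e)] (hV : ∀ x, ∃ e, x ∈ V e) (hmono : Monotone V)
    (hsmul : ∀ (a : MvPolynomial (Fin n) k) (e c : ℕ), a.totalDegree ≤ e →
      ∀ x ∈ V c, a • x ∈ V (e + c))
    {T : Set R} (hT : T.Finite)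
    (hgen : ∀ e, V e ≤ Submodule.span k
      {y | ∃ a : MvPolynomial (Fin n) k, ∃ m ∈ T, a.totalDegree ≤ e ∧ a • m = y}) :
    Filter.Tendsto (fun e : ℕ => (n.factorial : ℝ) * (Module.finrank k (V e) : ℝ) / (e : ℝ) ^ n)
      Filter.atTop (nhds ((Module.finrank (MvPolynomial (Fin n) k) R : ℕ) : ℝ)) := by
  obtain ⟨b, hb⟩ := exists_linearIndependent_of_le_finrank
    (R := MvPolynomial (Fin n) k) (M := R) le_rfl
  choose r hr using fun i => hV (b i)
  obtain ⟨h, hh, hc⟩ := exists_common_smul_eq_sum hb hT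
  choose! q hq using hc
  -- Bounds the degrees of all coefficients of `h • m` with respect to `b`, for `m ∈ T`.
  let C := hT.toFinset.sup fun m => Finset.univ.sup fun i => (q m i).totalDegree
  refine tendsto_of_le_of_le (k := k) (c := Finset.univ.sup r) (C := C) (fun e => ?_) fun e => ?_
  · exact mul_finrank_le hb fun i a ha => hsmul a e _ ha _
      (hmono (Finset.le_sup (Finset.mem_univ i)) (hr i))
  · refine finrank_le_mul b (h := h)
      ((map_ne_zero_iff _ (FaithfulSMul.algebraMap_injective _ R)).mpr hh) fun w hw => ?_
    have hle : Submodule.span k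
        {y | ∃ a : MvPolynomial (Fin n) k, ∃ m ∈ T, a.totalDegree ≤ e ∧ a • m = y} ≤
        (LinearMap.range (combination (k := k) (n := n) b (e + C))).comap
          (LinearMap.mulLeft k (algebraMap (MvPolynomial (Fin n) k) R h)) := by
      refine Submodule.span_le.mpr ?_
      rintro _ ⟨a, m, hm, ha, rfl⟩
      have hdeg : ∀ i, (a * q m i).totalDegree ≤ e + C := fun i =>
        (totalDegree_mul _ _).trans (add_le_add ha ((Finset.le_sup
          (f := fun i => (q m i).totalDegree) (Finset.mem_univ i)).trans (Finset.le_sup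
          (f := fun m => Finset.univ.sup fun i => (q m i).totalDegree) (hT.mem_toFinset.mpr hm))))
      refine ⟨fun i => ⟨a * q m i, (mem_restrictTotalDegree _ _ _).mpr (hdeg i)⟩, ?_⟩
      rw [combination_apply, LinearMap.mulLeft_apply, ← Algebra.smul_def, smul_comm, hq m hm,
        Finset.smul_sum]
      simp only [mul_smul]
    have := hle (hgen e hw)
    rwa [Submodule.mem_comap, LinearMap.mulLeft_apply, ← Algebra.smul_def] at this

end Growth

/-! ### The degree of the projective closure -/

/-- The dehomogenization of a polynomial, setting the first variable equal to `1`. -/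
def dehomogenization (k : Type*) [Field k] (N : ℕ) :
    MvPolynomial (Fin (N + 1)) k →ₐ[k] MvPolynomial (Fin N) k :=
  aeval (Fin.cons 1 X)

theorem eval_dehomogenization {N : ℕ} (F : MvPolynomial (Fin (N + 1)) k) (x : Fin N → k) :
    eval x (dehomogenization k N F) = eval (Fin.cons 1 x : Fin (N + 1) → k) F := by
  rw [dehomogenization, aeval_def, ← MvPolynomial.coe_eval₂Hom, ← RingHom.comp_apply]
  congr 1
  refine MvPolynomial.ringHom_ext (fun r => by simp) fun i => ?_
  refine Fin.cases ?_ (fun j => ?_) i <;> simp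

theorem totalDegree_dehomogenization_le {N : ℕ} (F : MvPolynomial (Fin (N + 1)) k) :
    (dehomogenization k N F).totalDegree ≤ F.totalDegree := by
  rw [dehomogenization, aeval_def, eval₂_eq]
  refine totalDegree_finsetSum_le fun s hs => ?_
  refine (totalDegree_mul _ _).trans ?_
  rw [algebraMap_eq, totalDegree_C, zero_add]
  refine (totalDegree_finsetProd _ _).trans (le_trans ?_ (le_totalDegree hs))
  refine Finset.sum_le_sum fun i _ => (totalDegree_pow _ _).trans ?_
  refine (Nat.mul_le_mul_left _ ?_).trans (mul_one _).le
  refine Fin.cases ?_ (fun j => ?_) i <;> simp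

theorem dehomogenization_homogenization [Infinite k] {N e : ℕ} {f : MvPolynomial (Fin N) k}
    (hf : f.totalDegree ≤ e) : dehomogenization k N (homogenization e f) = f :=
  MvPolynomial.funext fun x => by
    rw [eval_dehomogenization, eval_cons_one_homogenization hf]

/-- The functions on `Z` given by polynomials of degree at most `e`. -/
def coordFiltration {N : ℕ} (Z : Set (Fin N → k)) (e : ℕ) : Submodule k (CoordRing Z) :=
  (restrictTotalDegree (Fin N) k e).map (Ideal.Quotient.mkₐ k (vanishingIdeal k Z)).toLinearMap

instance {N : ℕ} (Z : Set (Fin N → k)) (e : ℕ) : Module.Finite k (coordFiltration Z e) := by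
  unfold coordFiltration
  infer_instance

theorem mk_mem_coordFiltration {N e : ℕ} (Z : Set (Fin N → k)) {f : MvPolynomial (Fin N) k}
    (hf : f.totalDegree ≤ e) : Ideal.Quotient.mk (vanishingIdeal k Z) f ∈ coordFiltration Z e :=
  Submodule.mem_map_of_mem (f := (Ideal.Quotient.mkₐ k (vanishingIdeal k Z)).toLinearMap)
    ((mem_restrictTotalDegree _ _ _).mpr hf)

theorem mem_coordFiltration_iff {N e : ℕ} {Z : Set (Fin N → k)} {x : CoordRing Z} :
    x ∈ coordFiltration Z e ↔
      ∃ f : MvPolynomial (Fin N) k, f.totalDegree ≤ e ∧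
        Ideal.Quotient.mk (vanishingIdeal k Z) f = x := by
  constructor
  · rintro ⟨f, hf, rfl⟩
    exact ⟨f, (mem_restrictTotalDegree _ _ _).mp hf, rfl⟩
  · rintro ⟨f, hf, rfl⟩
    exact mk_mem_coordFiltration Z hf

/-- Dehomogenization sends forms of degree `e` onto functions of degree at most `e`; the kernel
consists of the forms vanishing on the closure. -/
theorem hilbertFunction_projClosure [Infinite k] {N : ℕ} (Z : Set (Fin N → k)) (e : ℕ) :
    hilbertFunction (projClosure Z) e = Module.finrank k (coordFiltration Z e) := by
  let ψ : homogeneousSubmodule (Fin (N + 1)) k e →ₗ[k] CoordRing Z :=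
    (Ideal.Quotient.mkₐ k (vanishingIdeal k Z)).toLinearMap ∘ₗ
      (dehomogenization k N).toLinearMap ∘ₗ (homogeneousSubmodule (Fin (N + 1)) k e).subtype
  have hker : LinearMap.ker ψ = vanishingForms (projClosure Z) e := by
    ext F
    have h1 : F ∈ LinearMap.ker ψ ↔ dehomogenization k N F ∈ vanishingIdeal k Z :=
      Ideal.Quotient.eq_zero_iff_mem
    have h2 : F ∈ vanishingForms (projClosure Z) e ↔
        ∀ p ∈ projClosure Z, eval p.rep (F : MvPolynomial (Fin (N + 1)) k) = 0 := Iff.rfl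
    rw [h1, h2, forall_mem_projClosure_iff F.2]
    simp [mem_vanishingIdeal_iff, aeval_eq_eval, eval_dehomogenization]
  have hrange : LinearMap.range ψ = coordFiltration Z e := by
    ext x
    rw [mem_coordFiltration_iff]
    constructor
    · rintro ⟨F, rfl⟩
      exact ⟨_, (totalDegree_dehomogenization_le _).trans
        (IsHomogeneous.totalDegree_le F.2), rfl⟩
    · rintro ⟨f, hf, rfl⟩
      refine ⟨⟨homogenization e f, homogenization_isHomogeneous e f⟩, ?_⟩
      change Ideal.Quotient.mk _ (dehomogenization k N (homogenization e f)) = _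
      rw [dehomogenization_homogenization hf]
  rw [hilbertFunction, ← hker, ← hrange]
  exact (LinearMap.quotKerEquivRange ψ).finrank_eq

/-- `R` is algebraic over `A`, so passing to fraction fields does not change the rank. -/
theorem exists_fractionRing_hom {A R : Type*} [CommRing A] [IsDomain A] [CommRing R] [IsDomain R]
    [Algebra A R] [FaithfulSMul A R] [Module.Finite A R] :
    ∃ g : FractionRing A →+* FractionRing R,
      (∀ f : A, g (algebraMap A _ f) = algebraMap R _ (algebraMap A R f)) ∧
      letI : Module (FractionRing A) (FractionRing R) := g.toModule
      Module.Finite (FractionRing A) (FractionRing R) ∧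
        Module.finrank (FractionRing A) (FractionRing R) = Module.finrank A R := by
  let := FractionRing.liftAlgebra A (FractionRing R)
  refine ⟨algebraMap (FractionRing A) (FractionRing R), fun f => ?_, ?_⟩
  · rw [← IsScalarTower.algebraMap_apply, ← IsScalarTower.algebraMap_apply]
  · have h1 : Module.Finite (FractionRing A) (FractionRing R) := inferInstance
    have h2 := Algebra.IsAlgebraic.rank_fractionRing A R
    exact ⟨h1, congrArg Cardinal.toNat h2⟩

/-- The common value `d` is the rank of `k[Z]` over the polynomial ring. -/
theorem FilteredGenerates.exists_hasDegree [Infinite k] {N n : ℕ} {Z : Set (Fin N → k)}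
    {L : (Fin N → k) →ₗ[k] (Fin n → k)} {M : Set (MvPolynomial (Fin N) k)}
    (h : FilteredGenerates Z L M) (hM : M.Finite) (hZ : (vanishingIdeal k Z).IsPrime)
    (hinj : ∀ f, pullback L f ∈ vanishingIdeal k Z → f = 0) :
    ∃ d : ℕ, HasDegree (projClosure Z) n d ∧
      HasMorphismDegree Z (fun i => pullback L (X i)) d := by
  let : Algebra (MvPolynomial (Fin n) k) (CoordRing Z) :=
    (comorphism Z (fun i => pullback L (X i))).toRingHom.toAlgebra
  let : Module (MvPolynomial (Fin n) k) (CoordRing Z) := Algebra.toModule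
  have halg : ∀ a, algebraMap (MvPolynomial (Fin n) k) (CoordRing Z) a =
      comorphism Z (fun i => pullback L (X i)) a := fun _ => rfl
  have hsmul : ∀ (a : MvPolynomial (Fin n) k) (f : MvPolynomial (Fin N) k),
      a • Ideal.Quotient.mk (vanishingIdeal k Z) f =
        Ideal.Quotient.mk (vanishingIdeal k Z) (pullback L a * f) := fun a f => by
    rw [Algebra.smul_def, halg, comorphism_pullback_X, map_mul]
  have : IsScalarTower k (MvPolynomial (Fin n) k) (CoordRing Z) :=
    IsScalarTower.of_algebraMap_eq fun c => ((comorphism Z _).commutes c).symm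
  have : Module.Finite (MvPolynomial (Fin n) k) (CoordRing Z) := h.finite hM
  have : FaithfulSMul (MvPolynomial (Fin n) k) (CoordRing Z) := by
    rw [faithfulSMul_iff_algebraMap_injective, injective_iff_map_eq_zero]
    intro a ha
    rw [halg, comorphism_pullback_X] at ha
    exact hinj a (Ideal.Quotient.eq_zero_iff_mem.mp ha)
  refine ⟨Module.finrank (MvPolynomial (Fin n) k) (CoordRing Z), ?_, exists_fractionRing_hom⟩
  rw [HasDegree]
  simp only [hilbertFunction_projClosure]
  refine tendsto_finrank_filtration (coordFiltration Z) ?_ ?_ ?_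
    (hM.image (Ideal.Quotient.mk (vanishingIdeal k Z))) ?_
  · intro x
    obtain ⟨f, rfl⟩ := Ideal.Quotient.mk_surjective x
    exact ⟨_, mk_mem_coordFiltration Z le_rfl⟩
  · intro e e' he x hx
    obtain ⟨f, hf, rfl⟩ := mem_coordFiltration_iff.mp hx
    exact mk_mem_coordFiltration Z (hf.trans he)
  · intro a e c ha x hx
    obtain ⟨f, hf, rfl⟩ := mem_coordFiltration_iff.mp hx
    rw [hsmul]
    exact mk_mem_coordFiltration Z ((totalDegree_mul _ _).trans
      (add_le_add ((totalDegree_pullback_le L a).trans ha) hf))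
  · intro e x hx
    obtain ⟨f, hf, rfl⟩ := mem_coordFiltration_iff.mp hx
    obtain ⟨s, hs, t, ht, rfl⟩ := Submodule.mem_sup.mp (h e f hf)
    rw [map_add, Ideal.Quotient.eq_zero_iff_mem.mpr ht, add_zero]
    refine (filteredSpan_le fun a m hm hd => ?_ : _ ≤ (Submodule.span k
      {y | ∃ a : MvPolynomial (Fin n) k, ∃ m ∈ (Ideal.Quotient.mk (vanishingIdeal k Z)) '' M,
        a.totalDegree ≤ e ∧ a • m = y}).comap
          (Ideal.Quotient.mkₐ k (vanishingIdeal k Z)).toLinearMap) hs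
    exact Submodule.subset_span ⟨a, _, Set.mem_image_of_mem _ hm, by omega, hsmul a m⟩

/-! ### Irreducible sets and prime ideals -/

theorem isClosed_affine_iff {N : ℕ} {Z : Set (Fin N → k)} :
    IsClosed Z ↔ ∃ S : Set (MvPolynomial (Fin N) k), Z = affineZeros S := by
  rw [← isOpen_compl_iff]
  change Zᶜᶜ ∈ _ ↔ _
  rw [compl_compl]
  rfl

theorem isClosed_proj_iff {m : ℕ} {Z : Set (ℙ k (Fin m → k))} :
    IsClosed Z ↔ ∃ S : Set (MvPolynomial (Fin m) k), S ⊆ forms k m ∧ Z = projZeros S := by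
  rw [← isOpen_compl_iff]
  change Zᶜᶜ ∈ _ ↔ _
  rw [compl_compl]
  rfl

theorem mem_of_isClosed_affine {N : ℕ} {Z : Set (Fin N → k)} (hZ : IsClosed Z) {x : Fin N → k}
    (hx : ∀ f ∈ vanishingIdeal k Z, eval x f = 0) : x ∈ Z := by
  obtain ⟨S, rfl⟩ := isClosed_affine_iff.mp hZ
  exact fun f hf => hx f (mem_vanishingIdeal_iff.mpr fun y hy => by
    simpa [aeval_eq_eval] using hy f hf)

theorem isOpen_ne_zero {N : ℕ} (f : MvPolynomial (Fin N) k) :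
    IsOpen {x : Fin N → k | eval x f ≠ 0} := by
  rw [← isClosed_compl_iff, isClosed_affine_iff]
  exact ⟨{f}, by ext x; simp [affineZeros]⟩

theorem vanishingIdeal_isPrime {N : ℕ} {Z : Set (Fin N → k)} (hZ : IsIrreducible Z) :
    (vanishingIdeal k Z).IsPrime := by
  refine Ideal.isPrime_iff.mpr ⟨fun h => ?_, fun {f g} hfg => ?_⟩
  · obtain ⟨x, hx⟩ := hZ.1
    have h1 : (1 : MvPolynomial (Fin N) k) ∈ vanishingIdeal k Z := h ▸ Submodule.mem_top
    simpa using mem_vanishingIdeal_iff.mp h1 x hx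
  · by_contra! hne
    simp only [mem_vanishingIdeal_iff, aeval_eq_eval, not_forall] at hne
    obtain ⟨⟨x, hx, hfx⟩, y, hy, hgy⟩ := hne
    obtain ⟨z, hz, hfz, hgz⟩ := hZ.2 _ _ (isOpen_ne_zero f) (isOpen_ne_zero g)
      ⟨x, hx, hfx⟩ ⟨y, hy, hgy⟩
    have := mem_vanishingIdeal_iff.mp hfg z hz
    rw [aeval_eq_eval, map_mul, mul_eq_zero] at this
    exact this.elim hfz hgz

/-- By the Nullstellensatz, a product of two polynomials outside `P` is nonzero somewhere on the
locus. -/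
theorem isPreirreducible_zeroLocus [IsAlgClosed k] {N : ℕ} (P : Ideal (MvPolynomial (Fin N) k))
    [P.IsPrime] : IsPreirreducible (zeroLocus k P) := by
  have hmem : ∀ f : MvPolynomial (Fin N) k, (∀ x ∈ zeroLocus k P, eval x f = 0) → f ∈ P := by
    intro f hf
    rw [← IsPrime.vanishingIdeal_zeroLocus (K := k) P, mem_vanishingIdeal_iff]
    simpa [aeval_eq_eval] using hf
  have hopen : ∀ u : Set (Fin N → k), IsOpen u → (zeroLocus k P ∩ u).Nonempty →
      ∃ f ∉ P, ∀ x, eval x f ≠ 0 → x ∈ u := by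
    rintro u hu ⟨x, hx, hxu⟩
    obtain ⟨S, hS⟩ := isClosed_affine_iff.mp hu.isClosed_compl
    have : ∃ f ∈ S, eval x f ≠ 0 := by
      by_contra! h
      exact (hS ▸ (show x ∈ affineZeros S from h) : x ∈ uᶜ) hxu
    obtain ⟨f, hf, hfx⟩ := this
    refine ⟨f, fun hfP => hfx ?_, fun y hy => ?_⟩
    · simpa [aeval_eq_eval] using hx f hfP
    · by_contra hyu
      have hy' : y ∈ affineZeros S := hS ▸ hyu
      exact hy (hy' f hf)
  intro u v hu hv hxu hxv
  obtain ⟨f, hf, hfu⟩ := hopen u hu hxu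
  obtain ⟨g, hg, hgv⟩ := hopen v hv hxv
  have hfg : f * g ∉ P := fun h => (Ideal.IsPrime.mem_or_mem ‹_› h).elim hf hg
  have hex : ∃ x ∈ zeroLocus k P, eval x (f * g) ≠ 0 := by
    by_contra! h
    exact hfg (hmem _ h)
  obtain ⟨x, hx, hfgx⟩ := hex
  rw [map_mul, mul_ne_zero_iff] at hfgx
  exact ⟨x, hx, hfu x hfgx.1, hgv x hfgx.2⟩

theorem zeroLocus_nonempty [IsAlgClosed k] {σ : Type*} [Finite σ] (P : Ideal (MvPolynomial σ k))
    [P.IsPrime] : (zeroLocus k P).Nonempty := by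
  rw [Set.nonempty_iff_ne_empty]
  intro h
  have := IsPrime.vanishingIdeal_zeroLocus (K := k) P
  rw [h, vanishingIdeal_empty] at this
  exact Ideal.IsPrime.ne_top ‹_› this.symm

/-- The dimension of an affine algebraic set is that of its coordinate ring. -/
theorem topologicalKrullDim_eq [IsAlgClosed k] {N : ℕ} {Z : Set (Fin N → k)} (hZ : IsClosed Z) :
    topologicalKrullDim Z = ringKrullDim (CoordRing Z) := by
  rw [ringKrullDim_quotient]
  refine le_antisymm ?_ ?_
  -- Irreducible closed subsets give prime ideals, strictly reversing inclusion because a closed set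
  -- is recovered from its ideal.
  · rw [← Order.krullDim_orderDual (α := PrimeSpectrum.zeroLocus _)]
    have hprime : ∀ W : TopologicalSpace.IrreducibleCloseds Z,
        (vanishingIdeal k (Subtype.val '' (W : Set Z))).IsPrime := fun W =>
      vanishingIdeal_isPrime (W.isIrreducible.image _ continuous_subtype_val.continuousOn)
    refine Order.krullDim_le_of_strictMono (fun W => OrderDual.toDual
      ⟨⟨vanishingIdeal k (Subtype.val '' (W : Set Z)), hprime W⟩,
        vanishingIdeal_anti_mono (by rintro _ ⟨x, -, rfl⟩; exact x.2)⟩) ?_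
    intro W W' h
    have hle : vanishingIdeal k (Subtype.val '' (W' : Set Z)) ≤
        vanishingIdeal k (Subtype.val '' (W : Set Z)) :=
      vanishingIdeal_anti_mono (Set.image_mono h.le)
    refine lt_of_le_not_ge hle fun hge => h.not_ge ?_
    intro x hx
    obtain ⟨C, hC, hCW⟩ := isClosed_induced_iff.mp W.isClosed
    have hxC : x ∈ Subtype.val ⁻¹' C := by
      refine mem_of_isClosed_affine hC fun f hf => ?_
      have h1 : f ∈ vanishingIdeal k (Subtype.val '' (W : Set Z)) :=
        vanishingIdeal_anti_mono (by rw [← hCW]; exact Set.image_preimage_subset _ _) hf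
      have h2 := mem_vanishingIdeal_iff.mp (hge h1) x (Set.mem_image_of_mem _ hx)
      simpa [aeval_eq_eval] using h2
    rw [hCW] at hxC
    exact hxC
  -- Conversely primes give irreducible closed subsets; strictness is the Nullstellensatz.
  · rw [← Order.krullDim_orderDual (α := PrimeSpectrum.zeroLocus _)]
    have hsub : ∀ P : PrimeSpectrum.zeroLocus (R := MvPolynomial (Fin N) k) (vanishingIdeal k Z),
        zeroLocus k P.1.asIdeal ⊆ Z := fun P x hx =>
      mem_of_isClosed_affine hZ fun f hf => by
        simpa [aeval_eq_eval] using hx f (P.2 hf)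
    have hirr : ∀ P : PrimeSpectrum.zeroLocus (R := MvPolynomial (Fin N) k) (vanishingIdeal k Z),
        IsIrreducible (Subtype.val ⁻¹' zeroLocus k P.1.asIdeal : Set Z) := by
      refine fun P => ⟨?_, ?_⟩
      · obtain ⟨x, hx⟩ := zeroLocus_nonempty (k := k) P.1.asIdeal
        exact ⟨⟨x, hsub _ hx⟩, hx⟩
      · rintro u v hu hv ⟨x, hx, hxu⟩ ⟨y, hy, hyv⟩
        obtain ⟨u', hu', rfl⟩ := isOpen_induced_iff.mp hu
        obtain ⟨v', hv', rfl⟩ := isOpen_induced_iff.mp hv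
        obtain ⟨z, hz, hzu, hzv⟩ := isPreirreducible_zeroLocus P.1.asIdeal
          u' v' hu' hv' ⟨x, hx, hxu⟩ ⟨y, hy, hyv⟩
        exact ⟨⟨z, hsub _ hz⟩, hz, hzu, hzv⟩
    have hclosed : ∀ P : PrimeSpectrum.zeroLocus (R := MvPolynomial (Fin N) k) (vanishingIdeal k Z),
        IsClosed (Subtype.val ⁻¹' zeroLocus k P.1.asIdeal : Set Z) := by
      refine fun P => IsClosed.preimage continuous_subtype_val (isClosed_affine_iff.mpr
        ⟨P.1.asIdeal, ?_⟩)
      ext x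
      simp [affineZeros, mem_zeroLocus_iff, aeval_eq_eval]
    let F : (PrimeSpectrum.zeroLocus (R := MvPolynomial (Fin N) k) (vanishingIdeal k Z))ᵒᵈ →
      TopologicalSpace.IrreducibleCloseds Z := fun P => ⟨_, hirr P.ofDual, hclosed P.ofDual⟩
    have hF : ∀ P x, x ∈ F P ↔ (x : Fin N → k) ∈ zeroLocus k P.ofDual.1.asIdeal :=
      fun _ _ => Iff.rfl
    refine Order.krullDim_le_of_strictMono F fun P Q hPQ => ?_
    have hle : Q.ofDual.1.asIdeal ≤ P.ofDual.1.asIdeal := hPQ.le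
    refine lt_of_le_not_ge (fun x hx => ?_) fun hge => hPQ.not_ge ?_
    · rw [hF] at hx ⊢
      exact zeroLocus_anti_mono hle hx
    · change P.ofDual.1.asIdeal ≤ Q.ofDual.1.asIdeal
      rw [← IsPrime.vanishingIdeal_zeroLocus (K := k) P.ofDual.1.asIdeal,
        ← IsPrime.vanishingIdeal_zeroLocus (K := k) Q.ofDual.1.asIdeal]
      refine vanishingIdeal_anti_mono fun x hx => ?_
      have hx' : (⟨x, hsub _ hx⟩ : Z) ∈ F Q := hx
      have hx'' : (⟨x, hsub _ hx⟩ : Z) ∈ F P := hge hx'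
      rw [hF] at hx''
      exact hx''

/-! ### Cones over subsets of projective space -/

/-- The cone over a subset of projective space, without its vertex. -/
def puncturedCone {m : ℕ} (T : Set (ℙ k (Fin m → k))) : Set (Fin m → k) :=
  {v | ∃ h : v ≠ 0, Projectivization.mk k v h ∈ T}

theorem rep_mem_puncturedCone {m : ℕ} {T : Set (ℙ k (Fin m → k))} {p : ℙ k (Fin m → k)} :
    p.rep ∈ puncturedCone T ↔ p ∈ T := by
  simp [puncturedCone, Projectivization.mk_rep, Projectivization.rep_nonzero]

theorem smul_mem_puncturedCone {m : ℕ} {T : Set (ℙ k (Fin m → k))} {v : Fin m → k}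
    (hv : v ∈ puncturedCone T) {s : k} (hs : s ≠ 0) : s • v ∈ puncturedCone T := by
  obtain ⟨h, hT⟩ := hv
  refine ⟨smul_ne_zero hs h, ?_⟩
  have : Projectivization.mk k (s • v) (smul_ne_zero hs h) = Projectivization.mk k v h :=
    (Projectivization.mk_eq_mk_iff' k _ _ _ _).mpr ⟨s, rfl⟩
  rwa [this]

theorem puncturedCone_mono {m : ℕ} {T T' : Set (ℙ k (Fin m → k))} (h : T ⊆ T') :
    puncturedCone T ⊆ puncturedCone T' := fun _ ⟨hv, hT⟩ => ⟨hv, h hT⟩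

/-- The values of the components at `v` are the coefficients of the polynomial `s ↦ f (s v)`, which
has infinitely many roots. -/
theorem eval_homogeneousComponent_eq_zero [Infinite k] {m : ℕ} {f : MvPolynomial (Fin m) k}
    {v : Fin m → k} (h : ∀ s : k, s ≠ 0 → eval (s • v) f = 0) (i : ℕ) :
    eval v (homogeneousComponent i f) = 0 := by
  by_cases hi : f.totalDegree < i
  · rw [homogeneousComponent_eq_zero _ _ hi, map_zero]
  let q : Polynomial k :=
    ∑ j ∈ Finset.range (f.totalDegree + 1), Polynomial.monomial j (eval v (homogeneousComponent j f))
  have hq : ∀ s, q.eval s = eval (s • v) f := fun s => by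
    conv_rhs => rw [← sum_homogeneousComponent f]
    simp only [q, Polynomial.eval_finsetSum, Polynomial.eval_monomial, map_sum]
    refine Finset.sum_congr rfl fun j _ => ?_
    rw [eval_smul_of_isHomogeneous (homogeneousComponent_isHomogeneous j f), mul_comm]
  have hq0 : q = 0 := by
    refine Polynomial.eq_zero_of_infinite_isRoot q ((Set.finite_singleton (0 : k)).infinite_compl.mono
      fun s hs => ?_)
    change q.eval s = 0
    rw [hq]
    exact h s hs
  have := congrArg (fun p => Polynomial.coeff p i) hq0
  simp only [q, Polynomial.finsetSum_coeff, Polynomial.coeff_monomial, Polynomial.coeff_zero] at this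
  rwa [Finset.sum_ite_eq' _ i, if_pos (by simp; omega)] at this

theorem homogeneousComponent_mem_vanishingIdeal [Infinite k] {m : ℕ} (T : Set (ℙ k (Fin m → k)))
    {f : MvPolynomial (Fin m) k} (hf : f ∈ vanishingIdeal k (puncturedCone T)) (i : ℕ) :
    homogeneousComponent i f ∈ vanishingIdeal k (puncturedCone T) := by
  rw [mem_vanishingIdeal_iff] at hf ⊢
  intro v hv
  simp only [aeval_eq_eval] at hf ⊢
  exact eval_homogeneousComponent_eq_zero (fun s hs => hf _ (smul_mem_puncturedCone hv hs)) i

theorem isOpen_proj_ne_zero {m e : ℕ} {f : MvPolynomial (Fin m) k} (hf : f.IsHomogeneous e) :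
    IsOpen {p : ℙ k (Fin m → k) | eval p.rep f ≠ 0} := by
  rw [← isClosed_compl_iff]
  convert isClosed_projZeros (S := {f}) (Set.singleton_subset_iff.mpr ⟨e, hf⟩) using 1
  ext p
  simp [projZeros]

/-- The ideal is homogeneous, so primality may be tested on forms, whose nonvanishing loci are open
in projective space. -/
theorem vanishingIdeal_puncturedCone_isPrime [Infinite k] {m : ℕ} {T : Set (ℙ k (Fin m → k))}
    (hT : IsIrreducible T) : (vanishingIdeal k (puncturedCone T)).IsPrime := by
  let := gradedAlgebra (σ := Fin m) (R := k)
  refine Ideal.IsHomogeneous.isPrime_of_homogeneous_mem_or_mem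
    (𝒜 := homogeneousSubmodule (Fin m) k) ?_ ?_ ?_
  · intro i f hf
    have := homogeneousComponent_mem_vanishingIdeal T hf i
    rwa [← decomposition.decompose'_apply] at this
  · intro h
    obtain ⟨p, hp⟩ := hT.1
    have h1 : (1 : MvPolynomial (Fin m) k) ∈ vanishingIdeal k (puncturedCone T) :=
      h ▸ Submodule.mem_top
    simpa using mem_vanishingIdeal_iff.mp h1 _ (rep_mem_puncturedCone.mpr hp)
  · rintro f g ⟨a, hf⟩ ⟨b, hg⟩ hfg
    by_contra! hne
    simp only [mem_vanishingIdeal_iff, aeval_eq_eval, not_forall] at hne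
    obtain ⟨⟨v, ⟨hv0, hv⟩, hfv⟩, w, ⟨hw0, hw⟩, hgw⟩ := hne
    obtain ⟨p, hp, hfp, hgp⟩ := hT.2 _ _ (isOpen_proj_ne_zero hf) (isOpen_proj_ne_zero hg)
      ⟨_, hv, fun h => hfv ((eval_rep_mk_eq_zero_iff hf hv0).mp h)⟩
      ⟨_, hw, fun h => hgw ((eval_rep_mk_eq_zero_iff hg hw0).mp h)⟩
    have := mem_vanishingIdeal_iff.mp hfg _ (rep_mem_puncturedCone.mpr hp)
    rw [aeval_eq_eval, map_mul, mul_eq_zero] at this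
    exact this.elim hfp hgp

/-- The vertex of the cone supplies one more prime at the end of each chain, accounting for the `+
1` in the dimension of a cone. -/
theorem vanishingIdeal_puncturedCone_lt [Infinite k] {m : ℕ} {T : Set (ℙ k (Fin m → k))}
    (hT : T.Nonempty) : vanishingIdeal k (puncturedCone T) < vanishingIdeal k {(0 : Fin m → k)} := by
  obtain ⟨p, hp⟩ := hT
  have hp' := rep_mem_puncturedCone.mpr hp
  refine lt_of_le_not_ge (fun f hf => ?_) fun h => ?_
  · have h0 := mem_vanishingIdeal_iff.mp (homogeneousComponent_mem_vanishingIdeal T hf 0) _ hp'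
    rw [mem_vanishingIdeal_singleton_iff, aeval_eq_eval, eval_zero,
      constantCoeff_eq]
    simpa using h0
  · obtain ⟨j, hj⟩ := Function.ne_iff.mp p.rep_nonzero
    have h1 : (X j : MvPolynomial (Fin m) k) ∈ vanishingIdeal k {(0 : Fin m → k)} := by
      simp
    have := mem_vanishingIdeal_iff.mp (h h1) _ hp'
    exact hj (by simpa using this)

/-- The dimension of the cone over a subset of projective space. -/
theorem topologicalKrullDim_add_one_le [Infinite k] {m : ℕ} (T : Set (ℙ k (Fin m → k)))
    [Nonempty (TopologicalSpace.IrreducibleCloseds T)] :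
    topologicalKrullDim T + 1 ≤
      ringKrullDim (MvPolynomial (Fin m) k ⧸ vanishingIdeal k (puncturedCone T)) := by
  rw [topologicalKrullDim, ← Order.krullDim_withBot, ringKrullDim_quotient,
    ← Order.krullDim_orderDual (α := PrimeSpectrum.zeroLocus _)]
  have hprime : ∀ W : TopologicalSpace.IrreducibleCloseds T,
      (vanishingIdeal k (puncturedCone (Subtype.val '' (W : Set T)))).IsPrime := fun W =>
    vanishingIdeal_puncturedCone_isPrime
      (W.isIrreducible.image _ continuous_subtype_val.continuousOn)
  have hle : ∀ W : TopologicalSpace.IrreducibleCloseds T, vanishingIdeal k (puncturedCone T) ≤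
      vanishingIdeal k (puncturedCone (Subtype.val '' (W : Set T))) := fun W =>
    vanishingIdeal_anti_mono (puncturedCone_mono (by rintro _ ⟨x, -, rfl⟩; exact x.2))
  have hlt : ∀ W : TopologicalSpace.IrreducibleCloseds T,
      vanishingIdeal k (puncturedCone (Subtype.val '' (W : Set T))) <
        vanishingIdeal k {(0 : Fin m → k)} := fun W =>
    vanishingIdeal_puncturedCone_lt (W.isIrreducible.1.image _)
  have W₀ : TopologicalSpace.IrreducibleCloseds T := Classical.arbitrary _
  -- The added `⊥` goes to the ideal of the vertex. `W₀` is used only to place that ideal above the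
  -- ideal of the cone.
  let F : WithBot (TopologicalSpace.IrreducibleCloseds T) →
      (PrimeSpectrum.zeroLocus (R := MvPolynomial (Fin m) k)
        (vanishingIdeal k (puncturedCone T)))ᵒᵈ := fun W =>
    WithBot.recBotCoe
      (OrderDual.toDual ⟨⟨vanishingIdeal k {(0 : Fin m → k)}, inferInstance⟩,
        (hle W₀).trans (hlt W₀).le⟩)
      (fun W => OrderDual.toDual ⟨⟨_, hprime W⟩, hle W⟩) W
  refine Order.krullDim_le_of_strictMono F (WithBot.strictMono_iff.mpr ⟨?_, fun W => hlt W⟩)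
  intro W W' h
  have hanti : vanishingIdeal k (puncturedCone (Subtype.val '' (W' : Set T))) ≤
      vanishingIdeal k (puncturedCone (Subtype.val '' (W : Set T))) :=
    vanishingIdeal_anti_mono (puncturedCone_mono (Set.image_mono h.le))
  refine lt_of_le_not_ge hanti fun hge => h.not_ge ?_
  intro p hp
  obtain ⟨C, hC, hCW⟩ := isClosed_induced_iff.mp W.isClosed
  obtain ⟨S, hS, rfl⟩ := isClosed_proj_iff.mp hC
  have hpC : p ∈ Subtype.val ⁻¹' projZeros S := by
    intro f hf
    obtain ⟨e, he⟩ := hS hf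
    have h1 : f ∈ vanishingIdeal k (puncturedCone (Subtype.val '' (W : Set T))) := by
      rw [mem_vanishingIdeal_iff]
      rintro v ⟨hv0, q, hq, hqv⟩
      rw [← hCW] at hq
      have := hq f hf
      rw [hqv, eval_rep_mk_eq_zero_iff he] at this
      simpa [aeval_eq_eval] using this
    have h2 := mem_vanishingIdeal_iff.mp (hge h1) _
      (rep_mem_puncturedCone.mpr (Set.mem_image_of_mem _ hp))
    simpa [aeval_eq_eval] using h2
  rw [hCW] at hpC
  exact hpC

/-! ### Directions of lines -/

theorem isLine_mk_iff {N : ℕ} {l : Set (Fin N → k)} {v : Fin N → k} (hv : v ≠ 0) :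
    IsLine l (Projectivization.mk k v hv) ↔ ∃ a, l = Set.range fun t : k => a + t • v := by
  have h : ∀ a : Fin N → k, (AffineSubspace.mk' a (Submodule.span k {v}) : Set (Fin N → k)) =
      Set.range fun t : k => a + t • v := by
    intro a
    ext x
    rw [SetLike.mem_coe, AffineSubspace.mem_mk', Submodule.mem_span_singleton]
    refine exists_congr fun t => ?_
    rw [vsub_eq_sub, eq_sub_iff_add_eq, add_comm]
  simp only [IsLine, Projectivization.submodule_mk, h]

theorem mk_mem_directions_iff {N : ℕ} {Z : Set (Fin N → k)} {v : Fin N → k} (hv : v ≠ 0) :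
    Projectivization.mk k v hv ∈ directions Z ↔ ∃ a, ∀ t : k, a + t • v ∈ Z := by
  constructor
  · rintro ⟨l, hl, hlZ⟩
    obtain ⟨a, rfl⟩ := (isLine_mk_iff hv).mp hl
    exact ⟨a, fun t => hlZ ⟨t, rfl⟩⟩
  · rintro ⟨a, ha⟩
    refine ⟨_, (isLine_mk_iff hv).mpr ⟨a, rfl⟩, ?_⟩
    rintro _ ⟨t, rfl⟩
    exact ha t

/-- The leading forms of the equations of `Z` vanish at the directions of the lines in `Z`. -/
theorem eval_homogeneousComponent_of_line [Infinite k] {N e : ℕ} {Z : Set (Fin N → k)}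
    {f : MvPolynomial (Fin N) k} (hf : f ∈ vanishingIdeal k Z) (he : f.totalDegree ≤ e)
    {a v : Fin N → k} (ha : ∀ t : k, a + t • v ∈ Z) : eval v (homogeneousComponent e f) = 0 := by
  -- With `F` the homogenization, `q s = F (s, s a + v)`. For `s ≠ 0` this is `s ^ e` times the
  -- value of `f` at the point `a + s⁻¹ v` of the line; at `s = 0` it is the leading form at `v`.
  let q : Polynomial k := aeval (Fin.cons Polynomial.X fun i =>
    Polynomial.C (a i) * Polynomial.X + Polynomial.C (v i) : Fin (N + 1) → Polynomial k)
      (homogenization e f)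
  have hq : ∀ s, q.eval s = eval (Fin.cons s (s • a + v) : Fin (N + 1) → k)
      (homogenization e f) := by
    intro s
    simp only [q]
    rw [aeval_def, ← MvPolynomial.coe_eval₂Hom, ← Polynomial.coe_evalRingHom,
      ← RingHom.comp_apply]
    congr 1
    refine MvPolynomial.ringHom_ext (fun r => by simp) fun i => ?_
    refine Fin.cases (by simp) (fun j => ?_) i
    simp [mul_comm (a j)]
  have hq0 : q = 0 := by
    refine Polynomial.eq_zero_of_infinite_isRoot q
      ((Set.finite_singleton (0 : k)).infinite_compl.mono fun s hs => ?_)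
    have hs : s ≠ 0 := hs
    have h1 : (Fin.cons s (s • a + v) : Fin (N + 1) → k) =
        s • (Fin.cons 1 (a + s⁻¹ • v) : Fin (N + 1) → k) := by
      ext i
      refine Fin.cases ?_ (fun j => ?_) i
      · simp
      · simp [mul_add, hs]
    change q.eval s = 0
    rw [hq, h1, eval_smul_of_isHomogeneous (homogenization_isHomogeneous e f),
      eval_cons_one_homogenization he]
    have := mem_vanishingIdeal_iff.mp hf _ (ha s⁻¹)
    rw [aeval_eq_eval] at this
    rw [this, mul_zero]
  have h0 := hq 0
  rw [hq0, zero_smul, zero_add, eval_cons_zero_homogenization, Polynomial.eval_zero] at h0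
  exact h0.symm

/-- Passage to the associated graded ring: the homogeneous components of the members of `M` generate
modulo any ideal `J` containing the leading forms. -/
theorem FilteredGenerates.finite_of_leadingForms {N n : ℕ} {Z : Set (Fin N → k)}
    {L : (Fin N → k) →ₗ[k] (Fin n → k)} {M : Set (MvPolynomial (Fin N) k)}
    (h : FilteredGenerates Z L M) (hM : M.Finite) (J : Ideal (MvPolynomial (Fin N) k))
    (hJ : ∀ f ∈ vanishingIdeal k Z, ∀ e, f.totalDegree ≤ e → homogeneousComponent e f ∈ J) :
    ((Ideal.Quotient.mkₐ k J).comp (pullback L)).toRingHom.Finite := by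
  let T : Set (MvPolynomial (Fin N) k) :=
    ⋃ m ∈ M, (fun i => homogeneousComponent i m) '' Set.Iic m.totalDegree
  have hT : T.Finite := hM.biUnion fun m _ => (Set.finite_Iic _).image _
  refine finite_of_forall_mem_span _ (hT.image (Ideal.Quotient.mk J)) fun x => ?_
  set V := Submodule.span k {y | ∃ a, ∃ m ∈ Ideal.Quotient.mk J '' T,
    ((Ideal.Quotient.mkₐ k J).comp (pullback L)) a * m = y} with hV
  have hprod : ∀ e a, ∀ m ∈ M,
      Ideal.Quotient.mkₐ k J (homogeneousComponent e (pullback L a * m)) ∈ V := by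
    intro e a m hm
    conv in pullback L a * m => rw [← sum_homogeneousComponent a, ← sum_homogeneousComponent m]
    simp only [map_sum, Finset.sum_mul, Finset.mul_sum]
    refine sum_mem fun i hi => sum_mem fun j _ => ?_
    rw [homogeneousComponent_of_mem ((isHomogeneous_pullback L
      (homogeneousComponent_isHomogeneous j a)).mul (homogeneousComponent_isHomogeneous i m))]
    split_ifs with hij
    · rw [map_mul]
      refine Submodule.subset_span ⟨homogeneousComponent j a, _, Set.mem_image_of_mem _
        (Set.mem_biUnion hm ⟨i, ?_, rfl⟩), rfl⟩
      exact Nat.lt_succ_iff.mp (Finset.mem_range.mp hi)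
    · rw [map_zero]
      exact zero_mem _
  obtain ⟨f, rfl⟩ := Ideal.Quotient.mk_surjective x
  rw [← sum_homogeneousComponent f, map_sum]
  refine sum_mem fun e _ => ?_
  obtain ⟨s, hs, t, ht, hst⟩ := Submodule.mem_sup.mp (h e (homogeneousComponent e f)
    (homogeneousComponent_isHomogeneous e f).totalDegree_le)
  have hts : t = homogeneousComponent e f - s := eq_sub_of_add_eq' hst
  -- The degree control on `s` bounds that of the error `t`, so its degree `e` component lies in
  -- `J`.
  have htd : t.totalDegree ≤ e := by
    rw [hts]
    exact (totalDegree_sub _ _).trans (max_le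
      (homogeneousComponent_isHomogeneous e f).totalDegree_le
      (totalDegree_le_of_mem_filteredSpan hs))
  have hcomp : homogeneousComponent e f = homogeneousComponent e s + homogeneousComponent e t := by
    rw [← map_add, hst, homogeneousComponent_of_mem (homogeneousComponent_isHomogeneous e f),
      if_pos rfl]
  rw [hcomp, map_add, Ideal.Quotient.eq_zero_iff_mem.mpr (hJ t ht e htd), add_zero]
  exact (filteredSpan_le fun a m hm _ => hprod e a m hm :
    _ ≤ V.comap ((Ideal.Quotient.mkₐ k J).toLinearMap ∘ₗ homogeneousComponent e)) hs

/-- The dimension bound for the set of directions, when its image under a finite projection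
satisfies a nontrivial equation. -/
theorem FilteredGenerates.topologicalKrullDim_directions_le [Infinite k] {N n : ℕ}
    {Z : Set (Fin N → k)} {L : (Fin N → k) →ₗ[k] (Fin n → k)} {M : Set (MvPolynomial (Fin N) k)}
    (h : FilteredGenerates Z L M) (hM : M.Finite)
    [Nonempty (TopologicalSpace.IrreducibleCloseds (directions Z))]
    {g : MvPolynomial (Fin n) k} (hg : g ≠ 0)
    (hgL : ∀ a v : Fin N → k, (∀ t : k, a + t • v ∈ Z) → eval (L v) g = 0) :
    topologicalKrullDim (directions Z) + 1 + 1 ≤ n := by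
  refine (add_le_add_left (topologicalKrullDim_add_one_le (directions Z)) 1).trans ?_
  refine ringKrullDim_add_one_le_of_mem _ (h.finite_of_leadingForms hM _ ?_).to_isIntegral hg
    (Ideal.Quotient.eq_zero_iff_mem.mpr ?_)
  · intro f hf e he
    rw [mem_vanishingIdeal_iff]
    rintro v ⟨hv, hvZ⟩
    obtain ⟨a, ha⟩ := (mk_mem_directions_iff hv).mp hvZ
    rw [aeval_eq_eval]
    exact eval_homogeneousComponent_of_line hf he ha
  · change pullback L g ∈ _
    rw [mem_vanishingIdeal_iff]
    rintro v ⟨hv, hvZ⟩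
    obtain ⟨a, ha⟩ := (mk_mem_directions_iff hv).mp hvZ
    rw [aeval_eq_eval, eval_pullback]
    exact hgL a v ha

/-! ### Dominant maps have dense images -/

/-- By Chevalley the image is constructible, and by injectivity it contains the generic point. A
locally closed piece through the generic point has only zero equations, so it is a basic open set.
-/
theorem exists_basicOpen_subset_range {A S : Type*} [CommRing A] [IsDomain A] [CommRing S]
    {θ : A →+* S} (hθ : θ.FinitePresentation) (hinj : Function.Injective θ) :
    ∃ h : A, h ≠ 0 ∧ ∀ p : PrimeSpectrum A, h ∉ p.asIdeal →
      p ∈ Set.range (PrimeSpectrum.comap θ) := by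
  obtain ⟨D, hD⟩ := PrimeSpectrum.exists_constructibleSetData_iff.mpr
    (PrimeSpectrum.isConstructible_range_comap hθ)
  have hbot : (⟨⊥, Ideal.isPrime_bot⟩ : PrimeSpectrum A) ∈ Set.range (PrimeSpectrum.comap θ) := by
    obtain ⟨q, hq, hq'⟩ := Ideal.exists_comap_eq_of_mem_minimalPrimes_of_injective hinj ⊥
      (by rw [IsDomain.minimalPrimes_eq_singleton_bot]; rfl)
    exact ⟨⟨q, hq⟩, PrimeSpectrum.ext hq'⟩
  rw [← hD] at hbot
  simp only [PrimeSpectrum.ConstructibleSetData.toSet, Set.mem_iUnion] at hbot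
  obtain ⟨B, hB, hg, hf⟩ := hbot
  refine ⟨B.f, fun h0 => hf ?_, fun p hp => ?_⟩
  · rw [PrimeSpectrum.mem_zeroLocus, h0]
    simp
  · rw [← hD]
    simp only [PrimeSpectrum.ConstructibleSetData.toSet, Set.mem_iUnion]
    refine ⟨B, hB, ?_, fun h => hp (h rfl)⟩
    rw [PrimeSpectrum.mem_zeroLocus] at hg ⊢
    intro x hx
    have : x = 0 := hg hx
    rw [this]
    exact zero_mem _

/-- A prime `q` over the maximal ideal of `a` has a point `w` by the Nullstellensatz, and `w` lies
over `a`. -/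
theorem exists_ne_zero_forall_mem_image [IsAlgClosed k] {σ : Type*} [Finite σ] {n : ℕ}
    (I : Ideal (MvPolynomial σ k)) (θ : MvPolynomial (Fin n) k →ₐ[k] MvPolynomial σ k)
    (hinj : ∀ g, θ g ∈ I → g = 0) :
    ∃ h : MvPolynomial (Fin n) k, h ≠ 0 ∧ ∀ a : Fin n → k, eval a h ≠ 0 →
      ∃ w ∈ zeroLocus k I, ∀ f, eval w (θ f) = eval a f := by
  let ρ : MvPolynomial (Fin n) k →ₐ[k] MvPolynomial σ k ⧸ I := (Ideal.Quotient.mkₐ k I).comp θ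
  have hinj' : Function.Injective ρ.toRingHom := by
    refine (injective_iff_map_eq_zero _).mpr fun g hg => hinj g (Ideal.Quotient.eq_zero_iff_mem.mp hg)
  have hft : ρ.toRingHom.FiniteType := by
    refine RingHom.FiniteType.of_comp_finiteType (f := algebraMap k (MvPolynomial (Fin n) k)) ?_
    have : ρ.toRingHom.comp (algebraMap k (MvPolynomial (Fin n) k)) =
        algebraMap k (MvPolynomial σ k ⧸ I) := RingHom.ext fun c => ρ.commutes c
    rw [this, RingHom.finiteType_algebraMap]
    infer_instance
  obtain ⟨h, hh, hrange⟩ := exists_basicOpen_subset_range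
    (RingHom.FinitePresentation.of_finiteType.mp hft) hinj'
  refine ⟨h, hh, fun a ha => ?_⟩
  obtain ⟨q, hq⟩ := hrange ⟨vanishingIdeal k {a}, inferInstance⟩ (by
    simpa [mem_vanishingIdeal_singleton_iff, aeval_eq_eval] using ha)
  have hq : ∀ f, ρ f ∈ q.asIdeal ↔ eval a f = 0 := fun f => by
    have := SetLike.ext_iff.mp (congrArg PrimeSpectrum.asIdeal hq) f
    simpa [mem_vanishingIdeal_singleton_iff, aeval_eq_eval] using this
  obtain ⟨w, hw⟩ := zeroLocus_nonempty (k := k) (q.asIdeal.comap (Ideal.Quotient.mk I))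
  refine ⟨w, fun f hf => hw f ?_, fun f => ?_⟩
  · rw [Ideal.mem_comap, Ideal.Quotient.eq_zero_iff_mem.mpr hf]
    exact zero_mem _
  · have h1 : ρ (f - C (eval a f)) ∈ q.asIdeal := (hq _).mpr (by simp)
    have h2 := hw (θ (f - C (eval a f))) h1
    rw [← algebraMap_eq, map_sub, AlgHom.commutes, aeval_eq_eval] at h2
    simpa [sub_eq_zero] using h2

/-! ### The variety of parametrized lines and its image -/

/-- The ideal of the variety of pairs `(a, v)` such that `Z` contains the points `a + t v`. -/
def lineIdeal {N : ℕ} (Z : Set (Fin N → k)) : Ideal (MvPolynomial (Fin N ⊕ Fin N) k) :=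
  Ideal.span {F | ∃ f ∈ vanishingIdeal k Z, ∃ t : k,
    aeval (fun i => X (Sum.inl i) + C t * X (Sum.inr i)) f = F}

theorem mem_zeroLocus_lineIdeal {N : ℕ} {Z : Set (Fin N → k)} (hZ : IsClosed Z)
    {w : Fin N ⊕ Fin N → k} :
    w ∈ zeroLocus k (lineIdeal Z) ↔
      ∀ t : k, (fun i => w (Sum.inl i)) + t • (fun i => w (Sum.inr i)) ∈ Z := by
  have hev : ∀ (f : MvPolynomial (Fin N) k) (t : k),
      eval w (aeval (fun i => X (Sum.inl i) + C t * X (Sum.inr i)) f) =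
        eval ((fun i => w (Sum.inl i)) + t • (fun i => w (Sum.inr i))) f := by
    intro f t
    rw [aeval_def, ← MvPolynomial.coe_eval₂Hom, ← RingHom.comp_apply]
    congr 1
    exact MvPolynomial.ringHom_ext (fun r => by simp) fun i => by simp
  rw [lineIdeal, zeroLocus_span]
  constructor
  · intro h t
    refine mem_of_isClosed_affine hZ fun f hf => ?_
    have := h _ ⟨f, hf, t, rfl⟩
    rwa [aeval_eq_eval, hev] at this
  · rintro h _ ⟨f, hf, t, rfl⟩
    rw [aeval_eq_eval, hev]
    simpa [aeval_eq_eval] using mem_vanishingIdeal_iff.mp hf _ (h t)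

/-- Either the images of the directions of the lines in `Z` satisfy a nontrivial equation, or
they contain a nonempty open set. -/
theorem exists_equation_or_exists_open [IsAlgClosed k] {N n : ℕ} {Z : Set (Fin N → k)}
    (hZ : IsClosed Z) (L : (Fin N → k) →ₗ[k] (Fin n → k)) :
    (∃ g : MvPolynomial (Fin n) k, g ≠ 0 ∧
      ∀ a v : Fin N → k, (∀ t : k, a + t • v ∈ Z) → eval (L v) g = 0) ∨
    ∃ h : MvPolynomial (Fin n) k, h ≠ 0 ∧ ∀ u : Fin n → k, eval u h ≠ 0 →
      ∃ a v : Fin N → k, L v = u ∧ ∀ t : k, a + t • v ∈ Z := by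
  let θ : MvPolynomial (Fin n) k →ₐ[k] MvPolynomial (Fin N ⊕ Fin N) k :=
    (rename Sum.inr).comp (pullback L)
  have hθ : ∀ w f, eval w (θ f) = eval (L fun i => w (Sum.inr i)) f := fun w f => by
    rw [← eval_pullback]
    exact eval_rename _ _ _
  -- Injectivity modulo the ideal of pairs means that `(a, v) ↦ L v` is dominant; a failure is a
  -- nontrivial equation of the image.
  by_cases hinj : ∀ g, θ g ∈ lineIdeal Z → g = 0
  · right
    obtain ⟨h, hh, hw⟩ := exists_ne_zero_forall_mem_image _ θ hinj
    refine ⟨h, hh, fun u hu => ?_⟩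
    obtain ⟨w, hwZ, hwf⟩ := hw u hu
    refine ⟨_, _, ?_, (mem_zeroLocus_lineIdeal hZ).mp hwZ⟩
    ext i
    have := hwf (X i)
    rwa [hθ, eval_X, eval_X] at this
  · left
    push Not at hinj
    obtain ⟨g, hgI, hg⟩ := hinj
    refine ⟨g, hg, fun a v hav => ?_⟩
    have hw : Sum.elim a v ∈ zeroLocus k (lineIdeal Z) :=
      (mem_zeroLocus_lineIdeal hZ).mpr (by simpa using hav)
    have := hw _ hgI
    rw [aeval_eq_eval, hθ] at this
    simpa using this

theorem polyMap_pullback_X {N n : ℕ} (L : (Fin N → k) →ₗ[k] (Fin n → k)) (x : Fin N → k) :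
    polyMap (fun i => pullback L (X i)) x = L x := by
  ext i
  simp [polyMap, eval_pullback]

/-- An equation satisfied by all `L v` would force `dim Δ(Z) ≤ n - 2`, so the dominant case holds.
-/
theorem FilteredGenerates.exists_open [IsAlgClosed k] {N n : ℕ} {Z : Set (Fin N → k)}
    {L : (Fin N → k) →ₗ[k] (Fin n → k)} {M : Set (MvPolynomial (Fin N) k)}
    (h : FilteredGenerates Z L M) (hM : M.Finite) (hZ : IsClosed Z)
    (hdim : topologicalKrullDim (directions Z) + 1 = n) :
    ∃ U : Set (ℙ k (Fin n → k)), IsOpen U ∧ U.Nonempty ∧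
      ∀ v ∈ U, ∃ (l : Set (Fin N → k)) (w : ℙ k (Fin N → k)),
        IsLine l w ∧ l ⊆ Z ∧ IsLine (polyMap (fun i => pullback L (X i)) '' l) v := by
  have hne : Nonempty (TopologicalSpace.IrreducibleCloseds (directions Z)) := by
    by_contra hempty
    rw [not_nonempty_iff] at hempty
    rw [topologicalKrullDim, Order.krullDim_eq_bot] at hdim
    simp at hdim
  have hn : n ≠ 0 := by
    rintro rfl
    have h0 : 0 ≤ topologicalKrullDim (directions Z) := Order.krullDim_nonneg
    have h1 := add_le_add_left h0 1
    rw [hdim] at h1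
    have h2 : 0 + 1 ≤ 0 := by exact_mod_cast h1
    omega
  rcases exists_equation_or_exists_open hZ L with ⟨g, hg, hgL⟩ | ⟨q, hq, hqL⟩
  · have h1 := h.topologicalKrullDim_directions_le hM hg hgL
    rw [hdim] at h1
    have h2 : n + 1 ≤ n := by exact_mod_cast h1
    omega
  -- `q` need not be homogeneous: the open set is where some component of `q` is nonzero, and there
  -- `q` is nonzero at some multiple of the representative.
  let S : Set (MvPolynomial (Fin n) k) := Set.range fun i => homogeneousComponent i q
  have hS : S ⊆ forms k n := by
    rintro _ ⟨i, rfl⟩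
    exact ⟨i, homogeneousComponent_isHomogeneous i q⟩
  refine ⟨(projZeros S)ᶜ, (isClosed_projZeros hS).isOpen_compl, ?_, fun p hp => ?_⟩
  · have hqX : q * X ⟨0, Nat.pos_of_ne_zero hn⟩ ≠ 0 := mul_ne_zero hq (X_ne_zero _)
    have hex : ∃ u, eval u (q * X ⟨0, Nat.pos_of_ne_zero hn⟩) ≠ 0 := by
      by_contra! h0
      exact hqX (MvPolynomial.funext fun u => by rw [h0 u, map_zero])
    obtain ⟨u, hu⟩ := hex
    rw [map_mul, eval_X, mul_ne_zero_iff] at hu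
    have hu0 : u ≠ 0 := by
      rintro rfl
      exact hu.2 rfl
    refine ⟨Projectivization.mk k u hu0, fun hmem => hu.1 ?_⟩
    rw [← sum_homogeneousComponent q, map_sum]
    exact Finset.sum_eq_zero fun i _ =>
      (eval_rep_mk_eq_zero_iff (homogeneousComponent_isHomogeneous i q) hu0).mp
        (hmem _ ⟨i, rfl⟩)
  · have hex : ∃ s : k, s ≠ 0 ∧ eval (s • p.rep) q ≠ 0 := by
      by_contra! h0
      refine hp ?_
      rintro _ ⟨i, rfl⟩
      exact eval_homogeneousComponent_eq_zero h0 i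
    obtain ⟨s, hs, hsq⟩ := hex
    obtain ⟨a, v, hv, hav⟩ := hqL _ hsq
    have hsp : s • p.rep ≠ 0 := smul_ne_zero hs p.rep_nonzero
    have hv0 : v ≠ 0 := by
      rintro rfl
      rw [map_zero] at hv
      exact hsp hv.symm
    have hpmk : p = Projectivization.mk k (s • p.rep) hsp := by
      conv_lhs => rw [← p.mk_rep]
      exact ((Projectivization.mk_eq_mk_iff' k _ _ _ _).mpr ⟨s, rfl⟩).symm
    refine ⟨Set.range fun t : k => a + t • v, Projectivization.mk k v hv0,
      (isLine_mk_iff hv0).mpr ⟨a, rfl⟩, ?_, ?_⟩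
    · rintro _ ⟨t, rfl⟩
      exact hav t
    · rw [hpmk, isLine_mk_iff hsp]
      refine ⟨L a, ?_⟩
      rw [← Set.range_comp]
      congr 1
      ext1 t
      rw [Function.comp_apply, polyMap_pullback_X, map_add, map_smul, hv]

end KakeyaCover

end

/-! ### The proposition -/

theorem mainTheorem4 {k : Type*} [Field k] [IsAlgClosed k] {N n : ℕ}
    (X : Set (Fin N → k)) (hirr : IsIrreducible X) (hX : KakeyaCover.IsKakeya X n) :
    ∃ d : ℕ, KakeyaCover.HasDegree (KakeyaCover.projClosure X) n d ∧
      n ≤ N ∧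
      ∃ (φ : (Fin N → k) →ᵃ[k] (Fin n → k)) (p : Fin n → MvPolynomial (Fin N) k),
        KakeyaCover.IsIteratedProjection (N - n) X φ ∧
        (∀ x, φ x = KakeyaCover.polyMap p x) ∧
        KakeyaCover.IsFiniteMorphism X p ∧
        KakeyaCover.HasMorphismDegree X p d ∧
        KakeyaCover.IsKakeyaCover X p := by
  have hprime := KakeyaCover.vanishingIdeal_isPrime hirr
  have hdim : ringKrullDim (KakeyaCover.CoordRing X) = n := by
    rw [← KakeyaCover.topologicalKrullDim_eq hX.isClosed, hX.dim_eq]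
  have hnN : n ≤ N := by
    have h1 : ringKrullDim (KakeyaCover.CoordRing X) ≤ _ :=
      ringKrullDim_quotient_le (MvPolynomial.vanishingIdeal k X)
    rw [hdim, KakeyaCover.ringKrullDim_mvPolynomial_fin] at h1
    exact Nat.cast_le.mp h1
  obtain ⟨c, rfl⟩ := Nat.exists_eq_add_of_le hnN
  obtain ⟨L, M, hM, hproj, hgen, hinj⟩ :=
    KakeyaCover.exists_isIteratedProjection c X hprime hdim
  -- `HasDegree` is a limit, so it determines `d`: this is the degree of the closure, not just some
  -- number.
  obtain ⟨d, hdeg, hmor⟩ := hgen.exists_hasDegree hM hprime hinj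
  refine ⟨d, hdeg, hnN, L.toAffineMap, _, ?_,
    fun x => (KakeyaCover.polyMap_pullback_X L x).symm, hgen.finite hM, hmor,
    hX.isClosed, hX.dim_eq, hgen.exists_open hM hX.isClosed hX.dim_directions⟩
  rwa [Nat.add_sub_cancel_left]
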